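/- Let $\mu^{(k)}$, $k\in\mathbb N_0$, be finite non-negative Borel measures on $\mathbb R$ with bounded, infinite support. For each $k$ let $p_l^{(k)}$, $l\in\mathbb N_0$, be the orthonormal polynomials of $\mu^{(k)}$ ($\deg p_l^{(k)}=l$, positive leading coefficient), with recurrence $$x\,p_l^{(k)}(x)=b_{l+1}^{(k)}p_{l+1}^{(k)}(x)+a_l^{(k)}p_l^{(k)}(x)+b_l^{(k)}p_{l-1}^{(k)}(x),\qquad b_0^{(k)}=0,\quad p_{-1}^{(k)}=0,$$ let $K_l^{(k)}(x,y)=\sum_{i=0}^{l}p_i^{(k)}(x)p_i^{(k)}(y)$ be the Christoffel–Darboux kernels, and let $x_{l,1}^{(k)}<\dots<x_{l,l}^{(k)}$ be the roots of $p_l^{(k)}$. For real entries, $\binom{x}{y}=\frac{\Gamma(x+1)}{\Gamma(y+1)\Gamma(x-y+1)}$. Let $\alpha>0$ and let $\sigma_{n,k}=\binom{n-k+\alpha-1}{n-k}\big/\binom{n+\alpha}{n}$, $0\le k\le n$, be the weights of Cesàro $(C,\alpha)$ summation. With $\tau_n=\binom{n+\alpha}{n}^{-1}$, let $N_n=\tau_n\sum_{k=0}^n\frac1{\tau_k}$.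 Suppose that the family $\mu^{(k)}$ is in the mean Nevai class $M^{(C,\alpha)}(\Sigma_{l_a,l_b})$, i.e. (i) $\sup_{n,k}|a_n^{(k)}|<\infty$ and $\sup_{n,k}|b_n^{(k)}|<\infty$; (ii) $\lim_{n\to\infty}\sum_{k=0}^n\sigma_{n,k}|a_{k+l}^{(n-k)}-a_k^{(n-k)}|=0$ and $\lim_{n\to\infty}\sum_{k=0}^n\sigma_{n,k}|b_{k+l}^{(n-k)}-b_k^{(n-k)}|=0$ for all $l\in\mathbb N$; (iii) $\lim_{n\to\infty}\sum_{k=0}^n\sigma_{n,k}(a_k^{(n-k)})^{l_a}(b_k^{(n-k)})^{l_b}=\Sigma_{l_a,l_b}$ for all $l_a,l_b\in\mathbb N_0$, with limits $$\Sigma_{l_a,l_b}=\delta_{0,l_a}\,2^{-l_b}\binom{\frac{\alpha+l_b}{2}}{\frac{\alpha}{2}}^{-1}.$$ Then the equilibrium measure $\mu_\Sigma$, i.e. the weak limit of the mean measures $d\bar\mu_n=\sum_{k=0}^n\sigma_{n,k}|p_k^{(n-k)}|^2\,d\mu^{(n-k)}$, exists and is $$d\mu_\Sigma=\frac{1}{m^{(\alpha/2)}}\chi_{[-1,1]}(x)(1-x^2)^{\frac{\alpha-1}{2}}dx,\qquad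 m^{(\alpha/2)}=\int_{-1}^1(1-x^2)^{\frac{\alpha-1}{2}}dx=\pi\,2^{1-\alpha}\binom{\alpha-1}{\frac{\alpha}{2}}.$$ It is also the weak limit of the means of the Christoffel–Darboux kernels, $\frac1{N_n}\sum_{k=0}^n\sigma_{n,k}K_k^{(n-k)}(x,x)\,d\mu^{(n-k)}$, and of the mean root distributions, $\frac1{N_n}\sum_{k=0}^n\sigma_{n,k}\sum_{j=1}^{k+1}\delta_{x_{k+1,j}^{(n-k)}}$. Here weak convergence means convergence of the integrals of every continuous $f:\mathbb R\to\mathbb R$. In particular, if $f$ is a continuous real function on $[-1,1]$, then each of $$\sum_{k=0}^n\frac{\binom{n-k+\alpha-1}{n-k}}{\binom{n+\alpha}{n}}\int_{[-1,1]}f(x)|p_k^{(n-k)}(x)|^2\,d\mu^{(n-k)}(x),$$ $$\sum_{k=0}^n\frac{\binom{n-k+\alpha-1}{n-k}}{\binom{n+\alpha+1}{n}}\int_{[-1,1]}f(x)K_k^{(n-k)}(x,x)\,d\mu^{(n-k)}(x),$$ $$\sum_{k=0}^n\frac{\binom{n-k+\alpha-1}{n-k}}{\binom{n+\alpha+1}{n}}\sum_{\substack{1\le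 j\le k+1\\ x_{k+1,j}^{(n-k)}\in[-1,1]}}f(x_{k+1,j}^{(n-k)})$$ converges, as $n\to\infty$, to $\frac{1}{m^{(\alpha/2)}}\int_{-1}^1f(x)(1-x^2)^{\frac{\alpha-1}{2}}dx$. -/

import Mathlib

open MeasureTheory Filter Topology Polynomial

noncomputable section

namespace MeanNevai

/-! ### Orthonormal polynomials of a measure on the real line -/

/-- The standing assumptions on an orthogonality measure: it is finite, its support is bounded,
and its support is infinite, so that orthogonal polynomials of every degree exist. -/
structure IsOrthogonalityMeasure (μ : Measure ℝ) : Prop where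
  finite : IsFiniteMeasure μ
  bounded_support : Bornology.IsBounded μ.support
  infinite_support : μ.support.Infinite

/-- The inner product `⟨p, q⟩ = ∫ p q dμ` on real polynomials. -/
def polyInner (μ : Measure ℝ) (p q : ℝ[X]) : ℝ := ∫ x, p.eval x * q.eval x ∂μ

/-- The monic orthogonal polynomials of `μ`: Gram-Schmidt applied to `1, X, X ^ 2, …`. -/
def monicOrtho (μ : Measure ℝ) (n : ℕ) : ℝ[X] :=
  X ^ n - ∑ j : Fin n,
    C (polyInner μ (X ^ n) (monicOrtho μ j) / polyInner μ (monicOrtho μ j) (monicOrtho μ j)) *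
      monicOrtho μ j
termination_by n
decreasing_by all_goals exact j.2

/-- The orthonormal polynomial `p_n` of `μ`, of degree `n` with positive leading coefficient. -/
def orthoPoly (μ : Measure ℝ) (n : ℕ) : ℝ[X] :=
  C (Real.sqrt (polyInner μ (monicOrtho μ n) (monicOrtho μ n)))⁻¹ * monicOrtho μ n

/-- The diagonal recurrence coefficient `a_n = ⟨x p_n, p_n⟩`; see `three_term_recurrence`. -/
def jacobiA (μ : Measure ℝ) (n : ℕ) : ℝ := polyInner μ (X * orthoPoly μ n) (orthoPoly μ n)

/-- The off-diagonal recurrence coefficients: `b_0 = 0` and `b_{n+1} = ⟨x p_n, p_{n+1}⟩`;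
see `three_term_recurrence`. -/
def jacobiB (μ : Measure ℝ) : ℕ → ℝ
  | 0 => 0
  | n + 1 => polyInner μ (X * orthoPoly μ n) (orthoPoly μ (n + 1))

/-- The Christoffel-Darboux kernel `K_n(x, y) = ∑_{l ≤ n} p_l(x) p_l(y)`. -/
def cdKernel (μ : Measure ℝ) (n : ℕ) (x y : ℝ) : ℝ :=
  ∑ l ∈ Finset.range (n + 1), (orthoPoly μ l).eval x * (orthoPoly μ l).eval y

/-- The roots `x_{n,1} < … < x_{n,n}` of `p_n`, all real and simple. -/
def zeros (μ : Measure ℝ) (n : ℕ) : Finset ℝ := (orthoPoly μ n).roots.toFinset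

/-! ### The definitions above give the orthonormal polynomials and their recurrence -/

section facts

variable {μ : Measure ℝ}

theorem integrable_poly (h : IsOrthogonalityMeasure μ) (p q : ℝ[X]) :
    Integrable (fun x => p.eval x * q.eval x) μ := by
  have := h.finite
  have hK : IsCompact μ.support :=
    Metric.isCompact_of_isClosed_isBounded Measure.isClosed_support h.bounded_support
  have h1 : IntegrableOn (fun x => p.eval x * q.eval x) μ.support μ :=
    ContinuousOn.integrableOn_compact hK (by fun_prop)
  rwa [IntegrableOn, Measure.restrict_eq_self_of_ae_mem] at h1
  exact Measure.support_mem_ae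

theorem polyInner_comm (p q : ℝ[X]) : polyInner μ p q = polyInner μ q p := by
  simp only [polyInner, mul_comm]

theorem polyInner_X (p q : ℝ[X]) : polyInner μ (X * p) q = polyInner μ p (X * q) := by
  simp only [polyInner, eval_mul, eval_X]
  congr 1; ext x; ring

theorem polyInner_sub (h : IsOrthogonalityMeasure μ) (p q r : ℝ[X]) :
    polyInner μ (p - q) r = polyInner μ p r - polyInner μ q r := by
  simp only [polyInner, eval_sub, sub_mul]
  exact integral_sub (integrable_poly h p r) (integrable_poly h q r)

theorem polyInner_C_mul (c : ℝ) (p r : ℝ[X]) :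
    polyInner μ (C c * p) r = c * polyInner μ p r := by
  simp only [polyInner, eval_mul, eval_C, mul_assoc]
  exact integral_const_mul _ _

theorem polyInner_sum (h : IsOrthogonalityMeasure μ) {ι : Type*} (s : Finset ι) (c : ι → ℝ)
    (p : ι → ℝ[X]) (r : ℝ[X]) :
    polyInner μ (∑ i ∈ s, C (c i) * p i) r = ∑ i ∈ s, c i * polyInner μ (p i) r := by
  have : ∀ i ∈ s, c i * polyInner μ (p i) r = polyInner μ (C (c i) * p i) r :=
    fun i _ => (polyInner_C_mul _ _ _).symm
  rw [Finset.sum_congr rfl this]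
  simp only [polyInner, eval_finsetSum, Finset.sum_mul]
  exact integral_finsetSum _ fun i _ => integrable_poly h _ r

theorem polyInner_self_pos (h : IsOrthogonalityMeasure μ) {p : ℝ[X]} (hp : p ≠ 0) :
    0 < polyInner μ p p := by
  refine lt_of_le_of_ne (integral_nonneg fun x => mul_self_nonneg _) fun h0 => ?_
  have h1 := (integral_eq_zero_iff_of_nonneg (fun x => mul_self_nonneg (p.eval x))
    (integrable_poly h p p)).1 h0.symm
  refine h.infinite_support (Set.Finite.subset p.roots.toFinset.finite_toSet ?_)
  refine Measure.support_subset_of_isClosed (Finset.isClosed _) ?_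
  filter_upwards [h1] with x hx
  simpa [hp] using hx

theorem monicOrtho_sub_degree (n : ℕ) : (monicOrtho μ n).degree = n ∧ (monicOrtho μ n).Monic := by
  induction n using Nat.strong_induction_on with
  | _ n ih =>
    have h1 : (∑ j : Fin n,
      C (polyInner μ (X ^ n) (monicOrtho μ j) / polyInner μ (monicOrtho μ j) (monicOrtho μ j)) *
        monicOrtho μ j).degree < n := by
      refine (degree_sum_le _ _).trans_lt ((Finset.sup_lt_iff (WithBot.bot_lt_coe n)).2 ?_)
      intro j _
      refine (degree_mul_le _ _).trans_lt ?_
      rw [(ih j j.2).1]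
      refine (add_le_add_left degree_C_le _).trans_lt ?_
      rw [zero_add]
      exact WithBot.coe_lt_coe.2 j.2
    rw [monicOrtho]
    refine ⟨?_, ?_⟩
    · rw [degree_sub_eq_left_of_degree_lt (by simpa using h1)]; simp
    · exact monic_X_pow_sub h1

theorem monicOrtho_self_pos (h : IsOrthogonalityMeasure μ) (n : ℕ) :
    0 < polyInner μ (monicOrtho μ n) (monicOrtho μ n) :=
  polyInner_self_pos h (monicOrtho_sub_degree n).2.ne_zero

theorem monicOrtho_orthogonal (h : IsOrthogonalityMeasure μ) (n : ℕ) :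
    ∀ m < n, polyInner μ (monicOrtho μ n) (monicOrtho μ m) = 0 := by
  induction n using Nat.strong_induction_on with
  | _ n ih =>
    intro m hm
    rw [monicOrtho.eq_def μ n, polyInner_sub h, polyInner_sum h,
      Finset.sum_eq_single (⟨m, hm⟩ : Fin n)]
    · rw [div_mul_cancel₀ _ (monicOrtho_self_pos h m).ne', sub_self]
    · intro j _ hj
      have hjm : (j : ℕ) ≠ m := fun e => hj (Fin.ext e)
      rcases lt_or_gt_of_ne hjm with hlt | hgt
      · rw [polyInner_comm (monicOrtho μ j) (monicOrtho μ m), ih m hm j hlt, mul_zero]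
      · rw [ih j j.2 m hgt, mul_zero]
    · simp

theorem orthoPoly_degree (h : IsOrthogonalityMeasure μ) (n : ℕ) : (orthoPoly μ n).degree = n := by
  rw [orthoPoly, degree_C_mul (inv_ne_zero (Real.sqrt_pos.2 (monicOrtho_self_pos h n)).ne')]
  exact (monicOrtho_sub_degree n).1

theorem orthoPoly_leadingCoeff_pos (h : IsOrthogonalityMeasure μ) (n : ℕ) :
    0 < (orthoPoly μ n).leadingCoeff := by
  rw [orthoPoly, leadingCoeff_mul, leadingCoeff_C, (monicOrtho_sub_degree n).2.leadingCoeff,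
    mul_one]
  exact inv_pos.2 (Real.sqrt_pos.2 (monicOrtho_self_pos h n))

theorem orthoPoly_orthonormal (h : IsOrthogonalityMeasure μ) (m n : ℕ) :
    polyInner μ (orthoPoly μ m) (orthoPoly μ n) = if m = n then 1 else 0 := by
  rw [orthoPoly, orthoPoly, polyInner_C_mul, polyInner_comm (monicOrtho μ m) (C _ * _), polyInner_C_mul]
  split_ifs with hmn
  · subst hmn
    have h0 := monicOrtho_self_pos h m
    have h1 := (Real.sqrt_pos.2 h0).ne'
    field_simp
    rw [Real.sq_sqrt h0.le]
  · rcases lt_or_gt_of_ne hmn with hlt | hgt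
    · rw [monicOrtho_orthogonal h n m hlt]; simp
    · rw [polyInner_comm (monicOrtho μ n) (monicOrtho μ m), monicOrtho_orthogonal h m n hgt]; simp

theorem expand_of_degree_lt (h : IsOrthogonalityMeasure μ) (m : ℕ) :
    ∀ q : ℝ[X], q.degree < m →
      q = ∑ j ∈ Finset.range m, C (polyInner μ q (orthoPoly μ j)) * orthoPoly μ j := by
  induction m with
  | zero =>
    intro q hq
    simpa using hq
  | succ m ih =>
    intro q hq
    have hlc := (orthoPoly_leadingCoeff_pos h m).ne'
    have hnd : (orthoPoly μ m).natDegree = m := natDegree_eq_of_degree_eq_some (orthoPoly_degree h m)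
    obtain ⟨c, hc⟩ : ∃ c, c = q.coeff m / (orthoPoly μ m).leadingCoeff := ⟨_, rfl⟩
    obtain ⟨r, hr⟩ : ∃ r, r = q - C c * orthoPoly μ m := ⟨_, rfl⟩
    have hrdeg : r.degree < m := by
      rw [degree_lt_iff_coeff_zero]
      intro k hk
      rcases hk.eq_or_lt with rfl | hk
      · have : (orthoPoly μ m).coeff m = (orthoPoly μ m).leadingCoeff := by
          rw [leadingCoeff, hnd]
        rw [hr, coeff_sub, coeff_C_mul, this, hc, div_mul_cancel₀ _ hlc, sub_self]
      · rw [hr, coeff_sub, coeff_C_mul, coeff_eq_zero_of_degree_lt (hq.trans_le (by exact_mod_cast hk)),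
          coeff_eq_zero_of_degree_lt ((orthoPoly_degree h m).trans_lt (by exact_mod_cast hk))]
        simp
    have hrr := ih r hrdeg
    have hrj : ∀ j, polyInner μ r (orthoPoly μ j) =
        polyInner μ q (orthoPoly μ j) - c * (if m = j then 1 else 0) := by
      intro j
      rw [hr, polyInner_sub h, polyInner_C_mul, orthoPoly_orthonormal h]
    have hrm : polyInner μ r (orthoPoly μ m) = 0 := by
      rw [hrr, polyInner_sum h]
      refine Finset.sum_eq_zero fun j hj => ?_
      rw [orthoPoly_orthonormal h, if_neg (Finset.mem_range.1 hj).ne, mul_zero]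
    have hqm : polyInner μ q (orthoPoly μ m) = c := by
      have := hrj m
      rw [hrm, if_pos rfl] at this
      linarith
    rw [Finset.sum_range_succ, hqm]
    have hs : ∑ j ∈ Finset.range m, C (polyInner μ q (orthoPoly μ j)) * orthoPoly μ j = r := by
      conv_rhs => rw [hrr]
      refine Finset.sum_congr rfl fun j hj => ?_
      rw [hrj j, if_neg (Finset.mem_range.1 hj).ne', mul_zero, sub_zero]
    rw [hs, hr]; ring

theorem polyInner_orthoPoly_eq_zero (h : IsOrthogonalityMeasure μ) {n : ℕ} {q : ℝ[X]}
    (hq : q.degree < n) : polyInner μ q (orthoPoly μ n) = 0 := by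
  rw [expand_of_degree_lt h n q hq, polyInner_sum h]
  refine Finset.sum_eq_zero fun j hj => ?_
  rw [orthoPoly_orthonormal h, if_neg (Finset.mem_range.1 hj).ne, mul_zero]

theorem degree_X_mul_orthoPoly (h : IsOrthogonalityMeasure μ) (n : ℕ) :
    (X * orthoPoly μ n).degree = ((n + 1 : ℕ) : WithBot ℕ) := by
  rw [degree_mul, degree_X, orthoPoly_degree h]
  push_cast
  exact add_comm _ _

/-- `x p_n = b_{n+1} p_{n+1} + a_n p_n + b_n p_{n-1}` (for `n = 0` the last term vanishes, since
`b_0 = 0`). -/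
theorem three_term_recurrence (h : IsOrthogonalityMeasure μ) (n : ℕ) :
    X * orthoPoly μ n = C (jacobiB μ (n + 1)) * orthoPoly μ (n + 1) +
      C (jacobiA μ n) * orthoPoly μ n + C (jacobiB μ n) * orthoPoly μ (n - 1) := by
  have hlt : (X * orthoPoly μ n).degree < ((n + 2 : ℕ) : WithBot ℕ) := by
    rw [degree_X_mul_orthoPoly h]; exact_mod_cast Nat.lt_succ_self _
  conv_lhs => rw [expand_of_degree_lt h (n + 2) _ hlt]
  rw [Finset.sum_range_succ, Finset.sum_range_succ]
  have key : ∑ j ∈ Finset.range n,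
      C (polyInner μ (X * orthoPoly μ n) (orthoPoly μ j)) * orthoPoly μ j =
        C (jacobiB μ n) * orthoPoly μ (n - 1) := by
    cases n with
    | zero => simp [jacobiB]
    | succ n =>
      rw [Finset.sum_range_succ, Finset.sum_eq_zero, zero_add]
      · rw [polyInner_X, polyInner_comm]; rfl
      · intro j hj
        rw [polyInner_X, polyInner_comm, polyInner_orthoPoly_eq_zero h, C_0, zero_mul]
        rw [degree_X_mul_orthoPoly h]
        exact_mod_cast Nat.succ_lt_succ (Finset.mem_range.1 hj)
  rw [key]
  simp only [jacobiB, jacobiA]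
  ring

theorem jacobiB_succ_pos (h : IsOrthogonalityMeasure μ) (n : ℕ) : 0 < jacobiB μ (n + 1) := by
  have h0 := degree_X_mul_orthoPoly h n
  have h1 : (X * orthoPoly μ n).coeff (n + 1) = (orthoPoly μ n).leadingCoeff := by
    rw [coeff_X_mul, leadingCoeff, natDegree_eq_of_degree_eq_some (orthoPoly_degree h n)]
  have h2 : (orthoPoly μ (n + 1)).coeff (n + 1) = (orthoPoly μ (n + 1)).leadingCoeff := by
    rw [leadingCoeff, natDegree_eq_of_degree_eq_some (orthoPoly_degree h (n + 1))]
  have h3 : ∀ m ≤ n, (orthoPoly μ m).coeff (n + 1) = 0 := fun m hm =>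
    coeff_eq_zero_of_degree_lt ((orthoPoly_degree h m).trans_lt (by exact_mod_cast Nat.lt_succ_of_le hm))
  rw [three_term_recurrence h, coeff_add, coeff_add, coeff_C_mul, coeff_C_mul, coeff_C_mul, h2,
    h3 n le_rfl, h3 (n - 1) (Nat.sub_le _ _), mul_zero, mul_zero, add_zero, add_zero] at h1
  have h4 := orthoPoly_leadingCoeff_pos h n
  rw [← h1] at h4
  exact pos_of_mul_pos_left h4 (orthoPoly_leadingCoeff_pos h (n + 1)).le

end facts

/-! ### Summation methods and the mean Nevai class

A summation method is given by its weights `σ n k`, `0 ≤ k ≤ n`. A family of measures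
`μ⁽⁰⁾, μ⁽¹⁾, …` is a function `μ : ℕ → Measure ℝ`. -/

/-- The family `μ` belongs to the mean Nevai class `M^{(S)}(S_{l_a, l_b})` of the summation method
with weights `σ`, with limit values `S la lb`. -/
structure InMeanNevaiClass (σ : ℕ → ℕ → ℝ) (μ : ℕ → Measure ℝ) (S : ℕ → ℕ → ℝ) : Prop where
  bounded_a : ∃ A : ℝ, ∀ n k : ℕ, |jacobiA (μ k) n| ≤ A
  bounded_b : ∃ B : ℝ, ∀ n k : ℕ, |jacobiB (μ k) n| ≤ B
  shift_a : ∀ l : ℕ, Tendsto (fun n : ℕ => ∑ k ∈ Finset.range (n + 1),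
    σ n k * |jacobiA (μ (n - k)) (k + l) - jacobiA (μ (n - k)) k|) atTop (𝓝 0)
  shift_b : ∀ l : ℕ, Tendsto (fun n : ℕ => ∑ k ∈ Finset.range (n + 1),
    σ n k * |jacobiB (μ (n - k)) (k + l) - jacobiB (μ (n - k)) k|) atTop (𝓝 0)
  limits : ∀ la lb : ℕ, Tendsto (fun n : ℕ => ∑ k ∈ Finset.range (n + 1),
    σ n k * (jacobiA (μ (n - k)) k ^ la * jacobiB (μ (n - k)) k ^ lb)) atTop (𝓝 (S la lb))

/-- The mean measure `∑_{k ≤ n} σ_{n,k} |p_k^{(n-k)}|² dμ^{(n-k)}`. -/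
def meanMeasure (σ : ℕ → ℕ → ℝ) (μ : ℕ → Measure ℝ) (n : ℕ) : Measure ℝ :=
  ∑ k ∈ Finset.range (n + 1), ENNReal.ofReal (σ n k) •
    (μ (n - k)).withDensity fun x => ENNReal.ofReal ((orthoPoly (μ (n - k)) k).eval x ^ 2)

/-- The mean of the Christoffel-Darboux kernels,
`N_n⁻¹ ∑_{k ≤ n} σ_{n,k} K_k^{(n-k)}(x, x) dμ^{(n-k)}`. -/
def cdMeanMeasure (σ : ℕ → ℕ → ℝ) (N : ℕ → ℝ) (μ : ℕ → Measure ℝ) (n : ℕ) : Measure ℝ :=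
  ∑ k ∈ Finset.range (n + 1), ENNReal.ofReal (σ n k / N n) •
    (μ (n - k)).withDensity fun x => ENNReal.ofReal (cdKernel (μ (n - k)) k x x)

/-- The mean distribution of the roots,
`N_n⁻¹ ∑_{k ≤ n} σ_{n,k} ∑_{j ≤ k+1} δ_{x_{k+1,j}^{(n-k)}}`. -/
def zeroMeanMeasure (σ : ℕ → ℕ → ℝ) (N : ℕ → ℝ) (μ : ℕ → Measure ℝ) (n : ℕ) : Measure ℝ :=
  ∑ k ∈ Finset.range (n + 1), ENNReal.ofReal (σ n k / N n) •
    ∑ x ∈ zeros (μ (n - k)) (k + 1), Measure.dirac x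

/-- Convergence of the integrals of every continuous function. The test functions need not be
bounded: all measures considered here have bounded support. -/
def TendstoWeakly (ν : ℕ → Measure ℝ) (ν' : Measure ℝ) : Prop :=
  ∀ f : ℝ → ℝ, Continuous f →
    Integrable f ν' ∧ Tendsto (fun n => ∫ x, f x ∂(ν n)) atTop (𝓝 (∫ x, f x ∂ν'))

/-- The equilibrium measure of the family `μ` under the summation method with weights `σ`: the
weak limit of the mean measures. -/
def IsEquilibriumMeasure (σ : ℕ → ℕ → ℝ) (μ : ℕ → Measure ℝ) (ν : Measure ℝ) : Prop :=
  TendstoWeakly (meanMeasure σ μ) ν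

/-! ### Cesàro summation -/

/-- The binomial coefficient `Γ(x+1) / (Γ(y+1) Γ(x-y+1))` with real entries. -/
def gbinom (x y : ℝ) : ℝ := Real.Gamma (x + 1) / (Real.Gamma (y + 1) * Real.Gamma (x - y + 1))

def cesaroTau (α : ℝ) (n : ℕ) : ℝ := 1 / gbinom (n + α) n

def cesaroSeq (α : ℝ) (k : ℕ) : ℝ := gbinom (k + α - 1) k

/-- The weights of Cesàro `(C, α)` summation. -/
def cesaroWeight (α : ℝ) (n k : ℕ) : ℝ := cesaroTau α n * cesaroSeq α (n - k)

/-- The normalization constant `N_n = τ_n ∑_{k ≤ n} 1 / τ_k` of `(C, α)` summation. -/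
def cesaroNorm (α : ℝ) (n : ℕ) : ℝ :=
  cesaroTau α n * ∑ k ∈ Finset.range (n + 1), 1 / cesaroTau α k

/-! ### The Gegenbauer distribution -/

/-- `∫_{-1}^1 (1 - x²)^{(α-1)/2} dx` -/
def gegenbauerMass (α : ℝ) : ℝ := ∫ x in (-1 : ℝ)..1, (1 - x ^ 2) ^ ((α - 1) / 2)

/-- The measure with density `(1 - x²)^{(α-1)/2} / ∫_{-1}^1 (1 - t²)^{(α-1)/2} dt` on `[-1, 1]`. -/
def gegenbauerMeasure (α : ℝ) : Measure ℝ :=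
  (volume.restrict (Set.Icc (-1) 1)).withDensity fun x =>
    ENNReal.ofReal (1 / gegenbauerMass α * (1 - x ^ 2) ^ ((α - 1) / 2))

end MeanNevai

end

/-!
The proof is the method of moments, applied to the Jacobi operators of the measures.

Write `J_j` for the operator of multiplication by `x` in the basis of orthonormal polynomials of
`μ⁽ʲ⁾`. The `m`-th moment of the mean measure is the Cesàro mean of the diagonal matrix elements
`(J_{n-k} ^ m)_{kk}` (`jacobiMoment`). Each of them involves only coefficients with index at
distance at most `m` from `k`, so by the shift condition of the mean Nevai class these coefficients
may be frozen at the values `a_k`, `b_k`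
(`abs_jacobiMoment_sub_toeplitzMoment_le`). To stay away from the boundary of the half-line and to
use only forward shifts, the inner index is first moved from `k` to `k + m`, which does not change
the limit of a Cesàro mean along the antidiagonals `(n - k, k)` (`tendsto_cesaroMean_of_shift`).
With frozen coefficients the matrix element is `π⁻¹ ∫_0^π (a_k + 2 b_k cos θ) ^ m dθ`, a polynomial
in `a_k` and `b_k`, whose mean converges by the limit condition. Only the pure powers of `b_k`
survive, and the result is an arcsine moment divided by `gbinom ((α + m) / 2) (α / 2)`. By the Beta
integral and the reduction formula for powers of the cosine this is the `m`-th moment of the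
Gegenbauer distribution (`integral_pow_gegenbauerMeasure`). Bounded recurrence coefficients confine
all the measures to one compact interval (`ae_abs_le`), so convergence of moments is weak
convergence (`tendstoWeakly_of_moments`).

For the Cesàro weights, the mean of the Christoffel-Darboux kernels is exactly a weighted average
of the first `n + 1` mean measures, with weights `1 / τ_s ≥ 1`; hence it has the same limit
(`sum_cesaroSeq_mul_partialSum`, `tendsto_weighted_average`).

For the zeros, Gauss quadrature gives `∑_j x_j ^ m = ∑_{i ≤ k} ∑_j w_j x_j ^ m p_i(x_j)²` over the
zeros of `p_{k+1}`, and the quadrature is exact for all but `m` of the indices `i`. The power sums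
therefore differ from the moments of `K_k(x, x) dμ` by a bounded amount (`abs_sum_zeros_pow_sub_le`),
which is negligible after division by `N_n → ∞`.

Finally, the limit has no mass at `±1`, so the integrals may be restricted to `[-1, 1]`
(`TendstoWeakly.tendsto_setIntegral_Icc`).
-/

noncomputable section

namespace MeanNevai

/-! ### Matrix elements of powers of the Jacobi operator -/

/-- The matrix element `⟨x ^ m p_k, p_l⟩` of the `m`-th power of multiplication by `x`, in the
basis of orthonormal polynomials. -/
def jacobiMoment (μ : Measure ℝ) (m k l : ℕ) : ℝ :=
  polyInner μ (X ^ m * orthoPoly μ k) (orthoPoly μ l)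

section jacobi

variable {μ : Measure ℝ}

theorem orthoPoly_ne_zero (h : IsOrthogonalityMeasure μ) (n : ℕ) : orthoPoly μ n ≠ 0 := fun e => by
  have := orthoPoly_leadingCoeff_pos h n
  simp [e] at this

theorem exists_orthoPoly_zero_eq_C (h : IsOrthogonalityMeasure μ) :
    ∃ c : ℝ, c ≠ 0 ∧ orthoPoly μ 0 = C c := by
  have h1 := eq_C_of_degree_eq_zero (orthoPoly_degree h 0)
  refine ⟨(orthoPoly μ 0).coeff 0, fun h0 => orthoPoly_ne_zero h 0 ?_, h1⟩
  rw [h1, h0, C_0]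

theorem polyInner_add (h : IsOrthogonalityMeasure μ) (p q r : ℝ[X]) :
    polyInner μ (p + q) r = polyInner μ p r + polyInner μ q r := by
  simp only [polyInner, eval_add, add_mul]
  exact integral_add (integrable_poly h p r) (integrable_poly h q r)

theorem jacobiMoment_zero (h : IsOrthogonalityMeasure μ) (k l : ℕ) :
    jacobiMoment μ 0 k l = if k = l then 1 else 0 := by
  rw [jacobiMoment, pow_zero, one_mul, orthoPoly_orthonormal h]

theorem jacobiMoment_succ (h : IsOrthogonalityMeasure μ) (m k l : ℕ) :
    jacobiMoment μ (m + 1) k l = jacobiB μ (k + 1) * jacobiMoment μ m (k + 1) l +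
      jacobiA μ k * jacobiMoment μ m k l + jacobiB μ k * jacobiMoment μ m (k - 1) l := by
  have e : X ^ (m + 1) * orthoPoly μ k =
      C (jacobiB μ (k + 1)) * (X ^ m * orthoPoly μ (k + 1)) +
        C (jacobiA μ k) * (X ^ m * orthoPoly μ k) +
        C (jacobiB μ k) * (X ^ m * orthoPoly μ (k - 1)) := by
    rw [pow_succ, mul_assoc, three_term_recurrence h]; ring
  rw [jacobiMoment, e, polyInner_add h, polyInner_add h, polyInner_C_mul, polyInner_C_mul,
    polyInner_C_mul]
  rfl

theorem abs_jacobiMoment_le (h : IsOrthogonalityMeasure μ) {A B : ℝ}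
    (hA : ∀ n, |jacobiA μ n| ≤ A) (hB : ∀ n, |jacobiB μ n| ≤ B) (m k l : ℕ) :
    |jacobiMoment μ m k l| ≤ (A + 2 * B) ^ m := by
  have hA0 : 0 ≤ A := (abs_nonneg _).trans (hA 0)
  have hB0 : 0 ≤ B := (abs_nonneg _).trans (hB 0)
  induction m generalizing k with
  | zero => rw [jacobiMoment_zero h]; split_ifs <;> simp
  | succ m ih =>
    rw [jacobiMoment_succ h]
    calc _ ≤ |jacobiB μ (k + 1)| * |jacobiMoment μ m (k + 1) l| +
          |jacobiA μ k| * |jacobiMoment μ m k l| + |jacobiB μ k| * |jacobiMoment μ m (k - 1) l| := by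
          simp only [← abs_mul]; exact abs_add_three _ _ _
      _ ≤ B * (A + 2 * B) ^ m + A * (A + 2 * B) ^ m + B * (A + 2 * B) ^ m := by
          gcongr
          exacts [hB _, ih _, hA _, ih _, hB _, ih _]
      _ = _ := by ring

theorem integral_pow_mul_orthoPoly_sq (m k : ℕ) :
    ∫ x, x ^ m * (orthoPoly μ k).eval x ^ 2 ∂μ = jacobiMoment μ m k k := by
  simp only [jacobiMoment, polyInner, eval_mul, eval_pow, eval_X]
  congr 1; ext x; ring

/-- Bounded recurrence coefficients confine the measure: by the Markov inequality for `x ^ (2m)`,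
the mass outside `[-(R + 1), R + 1]` is at most a constant times `(R / (R + 1)) ^ (2m)`. -/
theorem ae_abs_le (h : IsOrthogonalityMeasure μ) {A B : ℝ}
    (hA : ∀ n, |jacobiA μ n| ≤ A) (hB : ∀ n, |jacobiB μ n| ≤ B) :
    ∀ᵐ x ∂μ, |x| ≤ A + 2 * B + 1 := by
  have := h.finite
  have hR : 0 ≤ A + 2 * B := by
    have := (abs_nonneg _).trans (hA 0)
    have := (abs_nonneg _).trans (hB 0)
    linarith
  obtain ⟨R, hRdef⟩ : ∃ R, R = A + 2 * B := ⟨_, rfl⟩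
  rw [← hRdef] at hR ⊢
  obtain ⟨c, hc0, hc⟩ := exists_orthoPoly_zero_eq_C h
  have hc2 : 0 < c ^ 2 := by positivity
  have key : ∀ m : ℕ, μ.real {x | R + 1 < |x|} ≤ ((R / (R + 1)) ^ 2) ^ m / c ^ 2 := by
    intro m
    have h1 : ∫ x, x ^ (2 * m) * c ^ 2 ∂μ ≤ R ^ (2 * m) := by
      have h2 := integral_pow_mul_orthoPoly_sq (μ := μ) (2 * m) 0
      rw [hc] at h2
      simp only [eval_C] at h2
      rw [h2, hRdef]
      exact (le_abs_self _).trans (abs_jacobiMoment_le h hA hB _ _ _)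
    have hint : Integrable (fun x => x ^ (2 * m) * c ^ 2) μ := by
      simpa using integrable_poly h (X ^ (2 * m)) (C (c ^ 2))
    have h3 := mul_meas_ge_le_integral_of_nonneg (μ := μ) (f := fun x => x ^ (2 * m) * c ^ 2)
      (ae_of_all _ fun x => by simp only [pow_mul, Pi.zero_apply]; positivity) hint
      ((R + 1) ^ (2 * m) * c ^ 2)
    have h4 : μ.real {x | R + 1 < |x|} ≤
        μ.real {x | (R + 1) ^ (2 * m) * c ^ 2 ≤ x ^ (2 * m) * c ^ 2} := by
      refine measureReal_mono fun x hx => ?_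
      simp only [Set.mem_ofPred_eq] at hx ⊢
      gcongr ?_ * _
      rw [pow_mul x, ← sq_abs x, ← pow_mul]
      gcongr
    have hpos : 0 < (R + 1) ^ (2 * m) * c ^ 2 := by positivity
    have h5 := (mul_le_mul_of_nonneg_left h4 hpos.le).trans (h3.trans h1)
    rw [← pow_mul, le_div_iff₀ hc2, div_pow, le_div_iff₀ (by positivity)]
    linarith
  have hlim : Tendsto (fun m : ℕ => ((R / (R + 1)) ^ 2) ^ m / c ^ 2) atTop (𝓝 (0 / c ^ 2)) := by
    refine (tendsto_pow_atTop_nhds_zero_of_lt_one (by positivity) ?_).div_const _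
    rw [sq_lt_one_iff₀ (by positivity), div_lt_one (by positivity)]
    linarith
  rw [zero_div] at hlim
  have h0 : μ.real {x | R + 1 < |x|} = 0 :=
    le_antisymm (ge_of_tendsto' hlim key) measureReal_nonneg
  rw [measureReal_eq_zero_iff] at h0
  rw [ae_iff]
  simpa using h0

/-! ### Zeros of orthogonal polynomials and Gauss quadrature -/

/-- A nonconstant factor of `p_n` changes sign on the support: if `p_n = g q` with `g ≥ 0` there,
then `∫ g q² = ⟨q, p_n⟩ = 0`, and `p_n` vanishes almost everywhere. -/
theorem not_ae_nonneg_of_dvd (h : IsOrthogonalityMeasure μ) {n : ℕ} {g : ℝ[X]}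
    (hdvd : g ∣ orthoPoly μ n) (hdeg : 0 < g.natDegree) : ¬ ∀ᵐ x ∂μ, 0 ≤ g.eval x := by
  intro hg
  obtain ⟨q, hq⟩ := hdvd
  have hp0 := orthoPoly_ne_zero h n
  have hg0 : g ≠ 0 := fun e => hp0 (by rw [hq, e, zero_mul])
  have hq0 : q ≠ 0 := fun e => hp0 (by rw [hq, e, mul_zero])
  have hqdeg : q.degree < n := by
    have h1 := natDegree_eq_of_degree_eq_some (orthoPoly_degree h n)
    rw [hq, natDegree_mul hg0 hq0] at h1
    rw [degree_eq_natDegree hq0]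
    exact_mod_cast (by omega : q.natDegree < n)
  have h1 := polyInner_orthoPoly_eq_zero h hqdeg
  have h2 := (integral_eq_zero_iff_of_nonneg_ae (f := fun x => q.eval x * (orthoPoly μ n).eval x)
    (by
      filter_upwards [hg] with x hx
      rw [hq, eval_mul, Pi.zero_apply, mul_left_comm]
      exact mul_nonneg hx (mul_self_nonneg _)) (integrable_poly h _ _)).1 h1
  have h3 : polyInner μ (orthoPoly μ n) (orthoPoly μ n) = 0 := by
    refine integral_eq_zero_of_ae ?_
    filter_upwards [h2] with x hx
    simp only [Pi.zero_apply] at hx ⊢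
    have : (orthoPoly μ n).eval x = g.eval x * q.eval x := by rw [hq, eval_mul]
    calc _ = g.eval x * (q.eval x * (orthoPoly μ n).eval x) := by rw [this]; ring
      _ = 0 := by rw [hx, mul_zero]
  rw [orthoPoly_orthonormal h, if_pos rfl] at h3
  exact one_ne_zero h3

theorem mem_zeros (h : IsOrthogonalityMeasure μ) {n : ℕ} {x : ℝ} :
    x ∈ zeros μ n ↔ (orthoPoly μ n).eval x = 0 := by
  simp [zeros, orthoPoly_ne_zero h]

theorem card_roots_orthoPoly (h : IsOrthogonalityMeasure μ) (n : ℕ) :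
    Multiset.card (orthoPoly μ n).roots = n := by
  obtain ⟨g, hg, hcard, hroots⟩ := exists_prod_multiset_X_sub_C_mul (orthoPoly μ n)
  have hdvd : g ∣ orthoPoly μ n := ⟨_, (mul_comm _ _).trans hg |>.symm⟩
  rw [natDegree_eq_of_degree_eq_some (orthoPoly_degree h n)] at hcard
  rcases Nat.eq_zero_or_pos g.natDegree with hnd | hnd
  · omega
  exfalso
  have hg0 : g ≠ 0 := fun e => by simp [e] at hnd
  have hroot : ∀ x, g.eval x ≠ 0 := fun x hx => by
    have : x ∈ g.roots := (mem_roots hg0).2 hx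
    simp [hroots] at this
  -- without real roots, `g` or `-g` is positive everywhere
  rcases lt_or_gt_of_ne (hroot 0) with h0 | h0
  · refine not_ae_nonneg_of_dvd h (neg_dvd.2 hdvd) (by rwa [natDegree_neg])
      (ae_of_all _ fun x => ?_)
    by_contra hx
    simp only [eval_neg, not_le] at hx
    obtain ⟨y, hy⟩ := mem_range_of_exists_le_of_exists_ge g.continuous ⟨0, h0.le⟩
      ⟨x, by linarith⟩
    exact hroot y hy
  · refine not_ae_nonneg_of_dvd h hdvd hnd (ae_of_all _ fun x => ?_)
    by_contra hx
    obtain ⟨y, hy⟩ := mem_range_of_exists_le_of_exists_ge g.continuous ⟨x, (not_le.1 hx).le⟩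
      ⟨0, h0.le⟩
    exact hroot y hy

theorem orthoPoly_roots_nodup (h : IsOrthogonalityMeasure μ) (n : ℕ) :
    (orthoPoly μ n).roots.Nodup := by
  rw [Multiset.nodup_iff_count_le_one]
  intro x
  by_contra hx
  rw [count_roots, not_le] at hx
  refine not_ae_nonneg_of_dvd h (g := (X - C x) ^ 2)
    ((pow_dvd_pow _ hx).trans (pow_rootMultiplicity_dvd _ _)) (by simp)
    (ae_of_all _ fun y => ?_)
  simp only [eval_pow]
  positivity

theorem card_zeros (h : IsOrthogonalityMeasure μ) (n : ℕ) : (zeros μ n).card = n := by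
  rw [zeros, Multiset.toFinset_card_of_nodup (orthoPoly_roots_nodup h n),
    card_roots_orthoPoly h n]

theorem abs_le_of_mem_zeros (h : IsOrthogonalityMeasure μ) {R : ℝ} (hR : ∀ᵐ x ∂μ, |x| ≤ R)
    {n : ℕ} {x : ℝ} (hx : x ∈ zeros μ n) : |x| ≤ R := by
  have hdvd : X - C x ∣ orthoPoly μ n := dvd_iff_isRoot.2 ((mem_zeros h).1 hx)
  refine abs_le.2 ⟨?_, ?_⟩
  · by_contra hlt
    refine not_ae_nonneg_of_dvd h hdvd (by simp) ?_
    filter_upwards [hR] with y hy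
    have := (abs_le.1 hy).1
    simp only [eval_sub, eval_X, eval_C]
    linarith
  · by_contra hlt
    refine not_ae_nonneg_of_dvd h (neg_dvd.2 hdvd) (by rw [natDegree_neg]; simp) ?_
    filter_upwards [hR] with y hy
    have := (abs_le.1 hy).2
    simp only [eval_neg, eval_sub, eval_X, eval_C]
    linarith

/-- The Christoffel-Darboux formula. -/
theorem sub_mul_cdKernel (h : IsOrthogonalityMeasure μ) (n : ℕ) (x y : ℝ) :
    (x - y) * cdKernel μ n x y = jacobiB μ (n + 1) *
      ((orthoPoly μ (n + 1)).eval x * (orthoPoly μ n).eval y -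
        (orthoPoly μ n).eval x * (orthoPoly μ (n + 1)).eval y) := by
  have hrec : ∀ n z, z * (orthoPoly μ n).eval z = jacobiB μ (n + 1) * (orthoPoly μ (n + 1)).eval z +
      jacobiA μ n * (orthoPoly μ n).eval z + jacobiB μ n * (orthoPoly μ (n - 1)).eval z := by
    intro n z
    have := congrArg (eval z) (three_term_recurrence h n)
    simpa using this
  induction n with
  | zero =>
    have hx := hrec 0 x
    have hy := hrec 0 y
    have hb : jacobiB μ 0 = 0 := rfl
    simp only [hb, zero_mul, add_zero, zero_add] at hx hy
    simp only [cdKernel, zero_add, Finset.sum_range_one]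
    linear_combination (orthoPoly μ 0).eval y * hx - (orthoPoly μ 0).eval x * hy
  | succ n ih =>
    have hx := hrec (n + 1) x
    have hy := hrec (n + 1) y
    simp only [Nat.add_sub_cancel] at hx hy
    rw [cdKernel, Finset.sum_range_succ, mul_add, ← cdKernel, ih]
    linear_combination (orthoPoly μ (n + 1)).eval y * hx - (orthoPoly μ (n + 1)).eval x * hy

theorem cdKernel_self_pos (h : IsOrthogonalityMeasure μ) (n : ℕ) (x : ℝ) :
    0 < cdKernel μ n x x := by
  obtain ⟨c, hc0, hc⟩ := exists_orthoPoly_zero_eq_C h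
  refine Finset.sum_pos' (fun i _ => mul_self_nonneg _) ⟨0, by simp, ?_⟩
  rw [hc, eval_C]
  exact mul_self_pos.2 hc0

/-- Discrete orthonormality at the zeros of `p_{n+1}`. The square matrix
`p_i(x_j) / √K_n(x_j, x_j)` has orthonormal columns by the Christoffel-Darboux formula, so its
rows are orthonormal too. -/
theorem sum_zeros_orthoPoly_mul (h : IsOrthogonalityMeasure μ) (n : ℕ) {i j : ℕ}
    (hi : i ≤ n) (hj : j ≤ n) :
    ∑ x ∈ zeros μ (n + 1), (cdKernel μ n x x)⁻¹ *
      ((orthoPoly μ i).eval x * (orthoPoly μ j).eval x) = if i = j then 1 else 0 := by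
  classical
  let U : Matrix (Fin (n + 1)) (zeros μ (n + 1)) ℝ := fun i x => (orthoPoly μ i).eval (x : ℝ)
  let V : Matrix (zeros μ (n + 1)) (Fin (n + 1)) ℝ := fun x i =>
    (cdKernel μ n x x)⁻¹ * (orthoPoly μ i).eval (x : ℝ)
  have hcard : Fintype.card (Fin (n + 1)) = Fintype.card (zeros μ (n + 1)) := by
    simp [card_zeros h]
  have hVU : V * U = 1 := by
    ext x y
    have e : (V * U) x y = (cdKernel μ n x x)⁻¹ * cdKernel μ n x y := by
      rw [Matrix.mul_apply, cdKernel.eq_def μ n (x : ℝ) (y : ℝ), ← Fin.sum_univ_eq_sum_range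
        (fun l => (orthoPoly μ l).eval (x : ℝ) * (orthoPoly μ l).eval (y : ℝ)), Finset.mul_sum]
      exact Finset.sum_congr rfl fun i _ => mul_assoc _ _ _
    rw [e, Matrix.one_apply]
    split_ifs with hxy
    · rw [hxy, inv_mul_cancel₀ (cdKernel_self_pos h n _).ne']
    · have h1 := sub_mul_cdKernel h n x y
      rw [(mem_zeros h).1 x.2, (mem_zeros h).1 y.2] at h1
      have h2 : (x : ℝ) - y ≠ 0 := sub_ne_zero.2 fun e => hxy (Subtype.ext e)
      have h3 : cdKernel μ n x y = 0 := by
        refine (mul_eq_zero.1 (h1.trans ?_)).resolve_left h2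
        ring
      rw [h3, mul_zero]
  have hUV : U * V = 1 := (Matrix.mul_eq_one_comm_of_card_eq _ _ _ hcard).2 hVU
  have := congrFun (congrFun hUV ⟨i, by omega⟩) ⟨j, by omega⟩
  rw [Matrix.mul_apply, Matrix.one_apply] at this
  simp only [Fin.mk.injEq] at this
  rw [← this, ← Finset.sum_coe_sort]
  refine Finset.sum_congr rfl fun x _ => ?_
  simp only [U, V]
  ring

/-- Gauss quadrature at the zeros of `p_{n+1}`, for products of two polynomials of degree at
most `n`. -/
theorem sum_zeros_mul_eq_polyInner (h : IsOrthogonalityMeasure μ) (n : ℕ) {q r : ℝ[X]}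
    (hq : q.degree < (n + 1 : ℕ)) (hr : r.degree < (n + 1 : ℕ)) :
    ∑ x ∈ zeros μ (n + 1), (cdKernel μ n x x)⁻¹ * (q.eval x * r.eval x) = polyInner μ q r := by
  have hq' := expand_of_degree_lt h (n + 1) q hq
  have hr' := expand_of_degree_lt h (n + 1) r hr
  have hR : polyInner μ q r = ∑ i ∈ Finset.range (n + 1),
      polyInner μ q (orthoPoly μ i) * polyInner μ r (orthoPoly μ i) := by
    conv_lhs => rw [hq']
    rw [polyInner_sum h]
    refine Finset.sum_congr rfl fun i _ => ?_
    rw [polyInner_comm (orthoPoly μ i) r]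
  rw [hR]
  have e : ∀ x, q.eval x * r.eval x = ∑ i ∈ Finset.range (n + 1), ∑ j ∈ Finset.range (n + 1),
      polyInner μ q (orthoPoly μ i) * polyInner μ r (orthoPoly μ j) *
        ((orthoPoly μ i).eval x * (orthoPoly μ j).eval x) := by
    intro x
    conv_lhs => rw [hq', hr']
    simp only [eval_finsetSum, eval_mul, eval_C, Finset.sum_mul_sum]
    refine Finset.sum_congr rfl fun i _ => Finset.sum_congr rfl fun j _ => ?_
    ring
  simp only [e, Finset.mul_sum]
  rw [Finset.sum_comm]
  refine Finset.sum_congr rfl fun i hi => ?_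
  rw [Finset.sum_comm, Finset.sum_eq_single i]
  · have := sum_zeros_orthoPoly_mul h n (Nat.lt_succ_iff.1 (Finset.mem_range.1 hi))
      (Nat.lt_succ_iff.1 (Finset.mem_range.1 hi))
    rw [if_pos rfl] at this
    conv_rhs => rw [← mul_one (polyInner μ q (orthoPoly μ i) * _), ← this, Finset.mul_sum]
    refine Finset.sum_congr rfl fun x _ => ?_
    ring
  · intro j hj hji
    have := sum_zeros_orthoPoly_mul h n (Nat.lt_succ_iff.1 (Finset.mem_range.1 hi))
      (Nat.lt_succ_iff.1 (Finset.mem_range.1 hj))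
    rw [if_neg hji.symm] at this
    rw [← mul_zero (polyInner μ q (orthoPoly μ i) * polyInner μ r (orthoPoly μ j)), ← this,
      Finset.mul_sum]
    refine Finset.sum_congr rfl fun x _ => ?_
    ring
  · exact fun hn => absurd hi hn

/-- The power sums of the zeros of `p_{n+1}` agree with the moments of `K_n(x, x) dμ` up to a
bounded error: quadrature turns `x ^ m` into `∑_i x ^ m p_i²`, and it is exact for all but the
last `m` of these terms. -/
theorem abs_sum_zeros_pow_sub_le (h : IsOrthogonalityMeasure μ) {A B : ℝ}
    (hA : ∀ n, |jacobiA μ n| ≤ A) (hB : ∀ n, |jacobiB μ n| ≤ B) (n m : ℕ) :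
    |∑ x ∈ zeros μ (n + 1), x ^ m - ∑ i ∈ Finset.range (n + 1), jacobiMoment μ m i i| ≤
      m * (2 * (A + 2 * B + 1) ^ m) := by
  have hA0 : 0 ≤ A := (abs_nonneg _).trans (hA 0)
  have hB0 : 0 ≤ B := (abs_nonneg _).trans (hB 0)
  let Q : ℕ → ℝ := fun i => ∑ x ∈ zeros μ (n + 1), (cdKernel μ n x x)⁻¹ *
    (x ^ m * ((orthoPoly μ i).eval x * (orthoPoly μ i).eval x))
  have e1 : ∑ x ∈ zeros μ (n + 1), x ^ m = ∑ i ∈ Finset.range (n + 1), Q i := by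
    rw [Finset.sum_comm]
    refine Finset.sum_congr rfl fun x _ => ?_
    rw [← Finset.mul_sum, ← Finset.mul_sum, ← cdKernel, mul_comm (x ^ m), ← mul_assoc,
      inv_mul_cancel₀ (cdKernel_self_pos h n x).ne', one_mul]
  have hexact : ∀ i, i + m ≤ n → Q i = jacobiMoment μ m i i := by
    intro i hi
    rw [jacobiMoment, ← sum_zeros_mul_eq_polyInner h n]
    · refine Finset.sum_congr rfl fun x _ => ?_
      rw [eval_mul, eval_pow, eval_X, mul_assoc]
    · rw [degree_mul, degree_X_pow, orthoPoly_degree h]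
      exact_mod_cast (by omega : m + i < n + 1)
    · rw [orthoPoly_degree h]
      exact_mod_cast (by omega : i < n + 1)
  have hQ : ∀ i ≤ n, |Q i| ≤ (A + 2 * B + 1) ^ m := by
    intro i hi
    have h1 := sum_zeros_orthoPoly_mul h n hi hi
    rw [if_pos rfl] at h1
    calc |Q i| ≤ ∑ x ∈ zeros μ (n + 1), |(cdKernel μ n x x)⁻¹ *
          (x ^ m * ((orthoPoly μ i).eval x * (orthoPoly μ i).eval x))| :=
          Finset.abs_sum_le_sum_abs _ _
      _ ≤ ∑ x ∈ zeros μ (n + 1), (A + 2 * B + 1) ^ m * ((cdKernel μ n x x)⁻¹ *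
          ((orthoPoly μ i).eval x * (orthoPoly μ i).eval x)) := by
          refine Finset.sum_le_sum fun x hx => ?_
          have hw := (inv_pos.2 (cdKernel_self_pos h n x)).le
          rw [abs_mul, abs_mul, abs_of_nonneg hw, abs_pow, abs_mul_self,
            mul_left_comm]
          have := abs_le_of_mem_zeros h (ae_abs_le h hA hB) hx
          have h2 := mul_self_nonneg ((orthoPoly μ i).eval x)
          gcongr
      _ = _ := by rw [← Finset.mul_sum, h1, mul_one]
  have hJ : ∀ i, |jacobiMoment μ m i i| ≤ (A + 2 * B + 1) ^ m := fun i =>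
    (abs_jacobiMoment_le h hA hB m i i).trans (pow_le_pow_left₀ (by positivity) (by linarith) _)
  rw [e1, ← Finset.sum_sub_distrib]
  calc _ ≤ ∑ i ∈ Finset.range (n + 1), |Q i - jacobiMoment μ m i i| :=
        Finset.abs_sum_le_sum_abs _ _
    _ ≤ ∑ i ∈ Finset.range (n + 1),
          (if n < i + m then 2 * (A + 2 * B + 1) ^ m else 0) := by
        refine Finset.sum_le_sum fun i hi => ?_
        have hi' : i ≤ n := Nat.lt_succ_iff.1 (Finset.mem_range.1 hi)
        split_ifs with hlt
        · have := abs_sub (Q i) (jacobiMoment μ m i i)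
          linarith [hQ i hi', hJ i]
        · rw [hexact i (by omega), sub_self, abs_zero]
    _ = ((Finset.range (n + 1)).filter fun i => n < i + m).card * (2 * (A + 2 * B + 1) ^ m) := by
        rw [← Finset.sum_filter, Finset.sum_const, nsmul_eq_mul]
    _ ≤ _ := by
        gcongr
        have hsub : ((Finset.range (n + 1)).filter fun i => n < i + m) ⊆
            Finset.Ico (n + 1 - m) (n + 1) := by
          intro i hi
          simp only [Finset.mem_filter, Finset.mem_range, Finset.mem_Ico] at hi ⊢
          omega
        refine (Finset.card_le_card hsub).trans ?_
        rw [Nat.card_Ico]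
        omega

end jacobi

/-! ### Weak convergence from moments -/

theorem integrable_of_ae_abs_le {ν : Measure ℝ} [IsFiniteMeasure ν] {R : ℝ}
    (hR : ∀ᵐ x ∂ν, |x| ≤ R) {f : ℝ → ℝ} (hf : Continuous f) : Integrable f ν := by
  have h1 : IntegrableOn f (Set.Icc (-R) R) ν :=
    hf.continuousOn.integrableOn_compact isCompact_Icc
  rwa [IntegrableOn, Measure.restrict_eq_self_of_ae_mem] at h1
  filter_upwards [hR] with x hx using abs_le.1 hx

/-- The method of moments, for measures on a common bounded interval. -/
theorem tendstoWeakly_of_moments {ν : ℕ → Measure ℝ} {ν' : Measure ℝ}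
    [∀ n, IsFiniteMeasure (ν n)] [IsFiniteMeasure ν'] {R : ℝ}
    (hR : ∀ n, ∀ᵐ x ∂(ν n), |x| ≤ R) (hR' : ∀ᵐ x ∂ν', |x| ≤ R)
    (hmom : ∀ m : ℕ, Tendsto (fun n => ∫ x, x ^ m ∂(ν n)) atTop (𝓝 (∫ x, x ^ m ∂ν'))) :
    TendstoWeakly ν ν' := by
  intro f hf
  refine ⟨integrable_of_ae_abs_le hR' hf, ?_⟩
  have hpoly : ∀ p : ℝ[X],
      Tendsto (fun n => ∫ x, p.eval x ∂(ν n)) atTop (𝓝 (∫ x, p.eval x ∂ν')) := by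
    intro p
    have e : ∀ (ρ : Measure ℝ) [IsFiniteMeasure ρ], (∀ᵐ x ∂ρ, |x| ≤ R) →
        ∫ x, p.eval x ∂ρ = ∑ i ∈ Finset.range (p.natDegree + 1), p.coeff i * ∫ x, x ^ i ∂ρ := by
      intro ρ _ hρ
      simp only [eval_eq_sum_range]
      rw [integral_finsetSum _ fun i _ => integrable_of_ae_abs_le hρ (by fun_prop)]
      exact Finset.sum_congr rfl fun i _ => integral_const_mul _ _
    rw [e ν' hR']
    simp only [fun n => e (ν n) (hR n)]
    exact tendsto_finsetSum _ fun i _ => (hmom i).const_mul _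
  have hmass : Tendsto (fun n => (ν n).real Set.univ) atTop (𝓝 (ν'.real Set.univ)) := by
    simpa using hmom 0
  rw [Metric.tendsto_atTop']
  intro ε hε
  set V := ν'.real Set.univ with hV
  have hV0 : 0 ≤ V := measureReal_nonneg
  obtain ⟨p, hp⟩ := exists_polynomial_near_of_continuousOn (-R) R f hf.continuousOn
    (ε / (4 * (V + 1))) (by positivity)
  have hclose : ∀ (ρ : Measure ℝ) [IsFiniteMeasure ρ], (∀ᵐ x ∂ρ, |x| ≤ R) →
      |(∫ x, p.eval x ∂ρ) - ∫ x, f x ∂ρ| ≤ ε / (4 * (V + 1)) * ρ.real Set.univ := by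
    intro ρ _ hρ
    rw [← integral_sub (integrable_of_ae_abs_le hρ p.continuous) (integrable_of_ae_abs_le hρ hf)]
    refine norm_integral_le_of_norm_le_const (μ := ρ) (f := fun x => p.eval x - f x) ?_
    filter_upwards [hρ] with x hx using (hp x (abs_le.1 hx)).le
  have h1 : ∀ᶠ n in atTop, (ν n).real Set.univ < V + 1 := hmass.eventually_lt_const (by linarith)
  have h2 := Metric.tendsto_atTop.1 (hpoly p) (ε / 2) (by positivity)
  obtain ⟨N, hN⟩ := eventually_atTop.1 (h1.and (eventually_atTop.2 h2))
  refine ⟨N, fun n hn => ?_⟩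
  obtain ⟨h3, h4⟩ := hN n hn.le
  rw [Real.dist_eq] at h4 ⊢
  have h5 := hclose (ν n) (hR n)
  have h6 := hclose ν' hR'
  have h7 : ε / (4 * (V + 1)) * (ν n).real Set.univ ≤ ε / 4 := by
    calc _ ≤ ε / (4 * (V + 1)) * (V + 1) := by gcongr
      _ = ε / 4 := by field_simp
  have h8 : ε / (4 * (V + 1)) * ν'.real Set.univ ≤ ε / 4 := by
    calc _ ≤ ε / (4 * (V + 1)) * (V + 1) := by rw [← hV]; gcongr; linarith
      _ = ε / 4 := by field_simp
  rw [abs_lt] at h4 ⊢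
  have h5' := abs_le.1 h5
  have h6' := abs_le.1 h6
  constructor <;> linarith [h4.1, h4.2, h5'.1, h5'.2, h6'.1, h6'.2]

/-- If the weak limit lives on `(-1, 1)`, then the integrals over `[-1, 1]` converge as well. The
mass outside `[-1, 1]` is at most the integral of `min(1, |x|) ^ j`, whose limit is small for
large `j`. -/
theorem TendstoWeakly.tendsto_setIntegral_Icc {ν : ℕ → Measure ℝ} {ν' : Measure ℝ}
    [∀ n, IsFiniteMeasure (ν n)] [IsFiniteMeasure ν'] (hν : TendstoWeakly ν ν')
    (h1 : ∀ᵐ x ∂ν', |x| < 1) {f : ℝ → ℝ} (hf : ContinuousOn f (Set.Icc (-1) 1)) :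
    Tendsto (fun n => ∫ x in Set.Icc (-1) 1, f x ∂(ν n)) atTop
      (𝓝 (∫ x in Set.Icc (-1) 1, f x ∂ν')) := by
  have hle : (-1 : ℝ) ≤ 1 := by norm_num
  let F : ℝ → ℝ := Set.IccExtend hle ((Set.Icc (-1 : ℝ) 1).domRestrict f)
  have hF : Continuous F := continuous_IccExtend_iff.2 hf.domRestrict
  have hFf : ∀ x ∈ Set.Icc (-1 : ℝ) 1, F x = f x := fun x hx => by
    simp [F, Set.IccExtend_of_mem hle _ hx, Set.domRestrict_apply]
  obtain ⟨K, hK⟩ : ∃ K, ∀ x, |F x| ≤ K := by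
    obtain ⟨K, hK⟩ := isCompact_Icc.exists_bound_of_continuousOn hf
    exact ⟨K, fun x => hK _ (Set.projIcc (-1) 1 hle x).2⟩
  have hK0 : 0 ≤ K := (abs_nonneg _).trans (hK 0)
  have hFint : ∀ (ρ : Measure ℝ) [IsFiniteMeasure ρ], Integrable F ρ := fun ρ _ =>
    Integrable.of_bound hF.aestronglyMeasurable K (ae_of_all _ hK)
  have hsplit : ∀ (ρ : Measure ℝ) [IsFiniteMeasure ρ], ∫ x in Set.Icc (-1) 1, f x ∂ρ =
      (∫ x, F x ∂ρ) - ∫ x in (Set.Icc (-1) 1)ᶜ, F x ∂ρ := fun ρ _ => by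
    rw [← integral_add_compl measurableSet_Icc (hFint ρ), add_sub_cancel_right]
    exact setIntegral_congr_fun measurableSet_Icc fun x hx => (hFf x hx).symm
  have hnull : ∫ x in (Set.Icc (-1) 1)ᶜ, F x ∂ν' = 0 := by
    refine setIntegral_measure_zero _ ?_
    rw [← mem_ae_iff]
    filter_upwards [h1] with x hx using abs_le.1 hx.le
  have hg : ∀ j : ℕ, Continuous fun x : ℝ => min 1 |x| ^ j := fun j => by fun_prop
  have hbound : ∀ (n j : ℕ), |∫ x in (Set.Icc (-1) 1)ᶜ, F x ∂(ν n)| ≤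
      K * ∫ x, min 1 |x| ^ j ∂(ν n) := by
    intro n j
    refine (norm_setIntegral_le_of_norm_le_const (f := F) (C := K)
      (measure_lt_top _ _) fun x _ => hK x).trans ?_
    gcongr
    have h2 := mul_meas_ge_le_integral_of_nonneg (μ := ν n) (f := fun x : ℝ => min 1 |x| ^ j)
      (ae_of_all _ fun x => by simp only [Pi.zero_apply]; positivity)
      (Integrable.of_bound (hg j).aestronglyMeasurable 1 (ae_of_all _ fun x => by
        rw [Real.norm_of_nonneg (by positivity)]
        exact pow_le_one₀ (by positivity) (min_le_left _ _))) 1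
    rw [one_mul] at h2
    refine le_trans (measureReal_mono fun x hx => ?_) h2
    have : 1 < |x| := by
      by_contra hlt
      exact hx (abs_le.1 (not_lt.1 hlt))
    simp [min_eq_left this.le]
  have hzero : Tendsto (fun j : ℕ => K * ∫ x, min 1 |x| ^ j ∂ν') atTop (𝓝 0) := by
    have : Tendsto (fun j : ℕ => ∫ x, min 1 |x| ^ j ∂ν') atTop (𝓝 (∫ _, (0 : ℝ) ∂ν')) := by
      refine tendsto_integral_of_dominated_convergence (fun _ => 1)
        (fun j => (hg j).aestronglyMeasurable) (integrable_const _) (fun j => ae_of_all _ fun x => ?_)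
        ?_
      · rw [Real.norm_of_nonneg (by positivity)]
        exact pow_le_one₀ (by positivity) (min_le_left _ _)
      · filter_upwards [h1] with x hx
        exact tendsto_pow_atTop_nhds_zero_of_lt_one (by positivity) (by simp [hx])
    simpa using this.const_mul K
  -- the bound holds for every `j`, so `j` may be chosen after `ε` and before `n`
  have hD : Tendsto (fun n => ∫ x in (Set.Icc (-1) 1)ᶜ, F x ∂(ν n)) atTop (𝓝 0) := by
    rw [Metric.tendsto_nhds]
    intro ε hε
    obtain ⟨j, hj⟩ := (hzero.eventually_lt_const hε).exists
    filter_upwards [((hν _ (hg j)).2.const_mul K).eventually_lt_const hj] with n hn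
    rw [Real.dist_0_eq_abs]
    exact (hbound n j).trans_lt hn
  simp only [hsplit]
  rw [hnull]
  exact (hν F hF).2.sub hD

/-! ### Moments of the Gegenbauer distribution -/

open ProbabilityTheory in
/-- The substitution `t = x²` in the Beta integral. -/
theorem integral_pow_mul_one_sub_sq_rpow (j : ℕ) {s : ℝ} (hs : -1 < s) :
    IntervalIntegrable (fun x : ℝ => x ^ (2 * j) * (1 - x ^ 2) ^ s) volume 0 1 ∧
      ∫ x in (0 : ℝ)..1, x ^ (2 * j) * (1 - x ^ 2) ^ s = beta (j + 1 / 2) (s + 1) / 2 := by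
  have ha : (0 : ℝ) < j + 1 / 2 := by positivity
  have hb : 0 < s + 1 := by linarith
  have hB := beta_pos ha hb
  have hnn : ∀ x, 0 ≤ betaPDFReal (j + 1 / 2) (s + 1) x := fun x => by
    by_cases hx : 0 < x ∧ x < 1
    · exact (betaPDFReal_pos hx.1 hx.2 ha hb).le
    · rw [betaPDFReal, if_neg hx]
  have hlin := lintegral_betaPDF_eq_one ha hb
  have hint : Integrable (betaPDFReal (j + 1 / 2) (s + 1)) := by
    rw [← lintegral_ofReal_ne_top_iff_integrable
      (measurable_betaPDFReal _ _).aestronglyMeasurable (ae_of_all _ hnn)]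
    exact hlin.trans_ne ENNReal.one_ne_top
  have hval : ∫ x, betaPDFReal (j + 1 / 2) (s + 1) x = 1 := by
    rw [integral_eq_lintegral_of_nonneg_ae (ae_of_all _ hnn)
      (measurable_betaPDFReal _ _).aestronglyMeasurable]
    exact (congrArg ENNReal.toReal hlin).trans ENNReal.toReal_one
  have hval' : ∫ x in Set.Ioi 0, betaPDFReal (j + 1 / 2) (s + 1) x = 1 := by
    rw [setIntegral_eq_integral_of_forall_compl_eq_zero, hval]
    intro x hx
    rw [betaPDFReal, if_neg fun h => hx h.1]
  -- `betaPDFReal` vanishes at the endpoint `1`, where `0 ^ s` need not; this null set is removed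
  -- afterwards
  have hsub : ∀ x ∈ Set.Ioi (0 : ℝ),
      (2 * x ^ ((2 : ℝ) - 1)) • betaPDFReal (j + 1 / 2) (s + 1) (x ^ (2 : ℝ)) =
        (Set.Ioc (0 : ℝ) 1).indicator (fun x => 2 / beta (j + 1 / 2) (s + 1) *
          (x ^ (2 * j) * (if x = 1 then 0 else (1 - x ^ 2) ^ s))) x := by
    intro x hx
    have hx0 : 0 < x := hx
    rw [Real.rpow_two, betaPDFReal]
    rcases lt_trichotomy x 1 with h1 | h1 | h1
    · have h2 : x ^ 2 < 1 := by nlinarith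
      rw [if_pos ⟨by positivity, h2⟩, Set.indicator_of_mem (Set.mem_Ioc.2 ⟨hx0, h1.le⟩),
        if_neg h1.ne]
      have e : x * (x ^ 2) ^ ((j : ℝ) + 1 / 2 - 1) = x ^ (2 * j) := by
        rw [← Real.rpow_natCast x 2, ← Real.rpow_mul hx0.le]
        nth_rewrite 1 [← Real.rpow_one x]
        rw [← Real.rpow_add hx0, ← Real.rpow_natCast]
        congr 1; push_cast; ring
      rw [← e, smul_eq_mul]
      norm_num
      ring
    · subst h1
      simp
    · have h2 : ¬ x ^ 2 < 1 := by nlinarith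
      rw [if_neg fun h => h2 h.2, Set.indicator_of_notMem fun h => by linarith [h.2], smul_zero]
  have hae : (fun x : ℝ => 2 / beta (j + 1 / 2) (s + 1) *
      (x ^ (2 * j) * (if x = 1 then 0 else (1 - x ^ 2) ^ s))) =ᵐ[volume]
      fun x => 2 / beta (j + 1 / 2) (s + 1) * (x ^ (2 * j) * (1 - x ^ 2) ^ s) := by
    have : ∀ᵐ x : ℝ, x ≠ 1 := Measure.ae_ne volume 1
    filter_upwards [this] with x hx
    rw [if_neg hx]
  have hinter : Set.Ioi (0 : ℝ) ∩ Set.Ioc 0 1 = Set.Ioc 0 1 :=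
    Set.inter_eq_right.2 fun x hx => hx.1
  constructor
  · rw [intervalIntegrable_iff_integrableOn_Ioc_of_le zero_le_one]
    have h1 := (integrableOn_Ioi_comp_rpow_iff (betaPDFReal (j + 1 / 2) (s + 1))
      (two_ne_zero)).2 hint.integrableOn
    rw [abs_two, integrableOn_congr_fun hsub measurableSet_Ioi,
      integrableOn_indicator_iff measurableSet_Ioc, Set.inter_comm, hinter, IntegrableOn,
      integrable_congr (ae_restrict_of_ae hae)] at h1
    refine (h1.const_mul (beta (j + 1 / 2) (s + 1) / 2)).congr (ae_of_all _ fun x => ?_)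
    generalize beta (j + 1 / 2) (s + 1) = b at hB
    simp only
    field_simp
  · have h1 := integral_comp_rpow_Ioi_of_pos (g := betaPDFReal (j + 1 / 2) (s + 1)) two_pos
    rw [hval', setIntegral_congr_fun measurableSet_Ioi hsub,
      setIntegral_indicator measurableSet_Ioc, hinter, integral_congr_ae (ae_restrict_of_ae hae),
      integral_const_mul, ← intervalIntegral.integral_of_le zero_le_one] at h1
    generalize beta (j + 1 / 2) (s + 1) = b at hB h1 ⊢
    field_simp at h1 ⊢
    linarith

theorem intervalIntegrable_one_sub_sq_rpow {s : ℝ} (hs : -1 < s) :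
    IntervalIntegrable (fun x : ℝ => (1 - x ^ 2) ^ s) volume (-1) 1 := by
  have h0 : IntervalIntegrable (fun x : ℝ => (1 - x ^ 2) ^ s) volume 0 1 := by
    simpa using (integral_pow_mul_one_sub_sq_rpow 0 hs).1
  have h1 : IntervalIntegrable (fun x : ℝ => (1 - x ^ 2) ^ s) volume (-1) 0 := by
    have := ((IntervalIntegrable.iff_comp_neg (by finiteness)).1 h0).symm
    simpa using this
  exact h1.trans h0

theorem integral_neg_one_one_pow_mul_rpow_even (j : ℕ) {s : ℝ} (hs : -1 < s) :
    ∫ x in (-1 : ℝ)..1, x ^ (2 * j) * (1 - x ^ 2) ^ s =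
      ProbabilityTheory.beta (j + 1 / 2) (s + 1) := by
  obtain ⟨hi, hv⟩ := integral_pow_mul_one_sub_sq_rpow j hs
  have hi' : IntervalIntegrable (fun x : ℝ => x ^ (2 * j) * (1 - x ^ 2) ^ s) volume (-1) 0 := by
    have := ((IntervalIntegrable.iff_comp_neg (by finiteness)).1 hi).symm
    simpa [pow_mul] using this
  have hv' : ∫ x in (-1 : ℝ)..0, x ^ (2 * j) * (1 - x ^ 2) ^ s =
      ProbabilityTheory.beta (j + 1 / 2) (s + 1) / 2 := by
    rw [← hv]
    have := intervalIntegral.integral_comp_neg (a := 0) (b := 1)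
      (fun x : ℝ => x ^ (2 * j) * (1 - x ^ 2) ^ s)
    rw [neg_zero] at this
    rw [← this]
    simp [pow_mul]
  rw [← intervalIntegral.integral_add_adjacent_intervals hi' hi, hv, hv']
  ring

theorem integral_neg_one_one_pow_mul_rpow_odd (j : ℕ) (s : ℝ) :
    ∫ x in (-1 : ℝ)..1, x ^ (2 * j + 1) * (1 - x ^ 2) ^ s = 0 := by
  have := intervalIntegral.integral_comp_neg (a := -1) (b := 1)
      (fun x : ℝ => x ^ (2 * j + 1) * (1 - x ^ 2) ^ s)
  have hodd : Odd (2 * j + 1) := ⟨j, rfl⟩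
  simp only [hodd.neg_pow, even_two.neg_pow, neg_neg, neg_mul, intervalIntegral.integral_neg]
    at this
  linarith

theorem gegenbauerMass_eq_beta {α : ℝ} (hα : 0 < α) :
    gegenbauerMass α = ProbabilityTheory.beta (1 / 2) ((α + 1) / 2) := by
  have := integral_neg_one_one_pow_mul_rpow_even 0 (s := (α - 1) / 2) (by linarith)
  simp only [mul_zero, pow_zero, one_mul, Nat.cast_zero, zero_add] at this
  rw [gegenbauerMass, this]
  congr 1; ring

theorem gegenbauerMass_pos {α : ℝ} (hα : 0 < α) : 0 < gegenbauerMass α := by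
  rw [gegenbauerMass_eq_beta hα]
  exact ProbabilityTheory.beta_pos (by norm_num) (by linarith)

/-- The closed form of the mass, by the duplication formula for the Gamma function. -/
theorem gegenbauerMass_eq_gbinom {α : ℝ} (hα : 0 < α) :
    gegenbauerMass α = Real.pi * (2 : ℝ) ^ (1 - α) * gbinom (α - 1) (α / 2) := by
  have h1 := Real.Gamma_mul_Gamma_add_half (α / 2)
  have h2 : Real.Gamma (α / 2) ≠ 0 := (Real.Gamma_pos_of_pos (by linarith)).ne'
  have h3 : Real.Gamma (α / 2 + 1) ≠ 0 := (Real.Gamma_pos_of_pos (by linarith)).ne'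
  have e1 : 2 * (α / 2) = α := by ring
  have e2 : α / 2 + 1 / 2 = (α + 1) / 2 := by ring
  have e3 : 1 / 2 + (α + 1) / 2 = α / 2 + 1 := by ring
  have e4 : α - 1 - α / 2 + 1 = α / 2 := by ring
  have hpi : Real.sqrt Real.pi * Real.sqrt Real.pi = Real.pi :=
    Real.mul_self_sqrt Real.pi_pos.le
  rw [e1, e2] at h1
  rw [gegenbauerMass_eq_beta hα, ProbabilityTheory.beta, gbinom, Real.Gamma_one_half_eq, e3,
    sub_add_cancel, e4, div_eq_iff h3]
  have : Real.pi * (2 : ℝ) ^ (1 - α) * (Real.Gamma α / (Real.Gamma (α / 2 + 1) *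
      Real.Gamma (α / 2))) * Real.Gamma (α / 2 + 1) =
      Real.sqrt Real.pi * (Real.Gamma α * 2 ^ (1 - α) * Real.sqrt Real.pi) /
        Real.Gamma (α / 2) := by
    nth_rewrite 1 [← hpi]
    field_simp
  rw [this, ← h1]
  field_simp

theorem integral_gegenbauerMeasure {α : ℝ} (hα : 0 < α) (f : ℝ → ℝ) :
    ∫ x, f x ∂(gegenbauerMeasure α) = 1 / gegenbauerMass α *
      ∫ x in (-1 : ℝ)..1, f x * (1 - x ^ 2) ^ ((α - 1) / 2) := by
  rw [gegenbauerMeasure, integral_withDensity_eq_integral_toReal_smul (by fun_prop)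
    (ae_of_all _ fun _ => ENNReal.ofReal_lt_top), intervalIntegral.integral_of_le (by norm_num),
    ← integral_Icc_eq_integral_Ioc, ← integral_const_mul]
  refine setIntegral_congr_fun measurableSet_Icc fun x hx => ?_
  have h1 : 0 ≤ 1 - x ^ 2 := by nlinarith [hx.1, hx.2]
  have h2 := gegenbauerMass_pos hα
  rw [ENNReal.toReal_ofReal (by positivity), smul_eq_mul]
  ring

theorem isFiniteMeasure_gegenbauerMeasure {α : ℝ} (hα : 0 < α) :
    IsFiniteMeasure (gegenbauerMeasure α) := by
  refine isFiniteMeasure_withDensity_ofReal ?_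
  have h1 := (intervalIntegrable_iff_integrableOn_Icc_of_le (by norm_num)).1
    (intervalIntegrable_one_sub_sq_rpow (s := (α - 1) / 2) (by linarith))
  exact (h1.const_mul _).2

theorem ae_abs_lt_one_gegenbauerMeasure (α : ℝ) : ∀ᵐ x ∂(gegenbauerMeasure α), |x| < 1 := by
  refine (withDensity_absolutelyContinuous _ _).ae_le ?_
  have h1 : ∀ᵐ x : ℝ, x ≠ 1 := Measure.ae_ne volume 1
  have h2 : ∀ᵐ x : ℝ, x ≠ -1 := Measure.ae_ne volume (-1)
  filter_upwards [ae_restrict_mem measurableSet_Icc, ae_restrict_of_ae h1, ae_restrict_of_ae h2]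
    with x hx hx1 hx2
  exact abs_lt.2 ⟨lt_of_le_of_ne hx.1 hx2.symm, lt_of_le_of_ne hx.2 hx1⟩

theorem setIntegral_Icc_gegenbauerMeasure {α : ℝ} (hα : 0 < α) (f : ℝ → ℝ) :
    ∫ x in Set.Icc (-1) 1, f x ∂(gegenbauerMeasure α) = 1 / gegenbauerMass α *
      ∫ x in (-1 : ℝ)..1, f x * (1 - x ^ 2) ^ ((α - 1) / 2) := by
  rw [← integral_gegenbauerMeasure hα, Measure.restrict_eq_self_of_ae_mem]
  filter_upwards [ae_abs_lt_one_gegenbauerMeasure α] with x hx using abs_le.1 hx.le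

theorem integral_cos_pow_zero_pi_even (j : ℕ) :
    ∫ θ in (0 : ℝ)..Real.pi, Real.cos θ ^ (2 * j) =
      Real.sqrt Real.pi * Real.Gamma (j + 1 / 2) / Real.Gamma (j + 1) := by
  induction j with
  | zero =>
    simp only [mul_zero, pow_zero, Nat.cast_zero, zero_add, Real.Gamma_one, Real.Gamma_one_half_eq]
    simp [Real.mul_self_sqrt Real.pi_pos.le]
  | succ j ih =>
    have h1 : ((j + 1 : ℕ) : ℝ) + 1 / 2 = (j + 1 / 2) + 1 := by push_cast; ring
    have h2 : ((j + 1 : ℕ) : ℝ) + 1 = (j + 1) + 1 := by push_cast; ring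
    have h3 : Real.Gamma ((j : ℝ) + 1) ≠ 0 := (Real.Gamma_pos_of_pos (by positivity)).ne'
    rw [mul_add, mul_one, integral_cos_pow, ih, h1, h2,
      Real.Gamma_add_one (s := (j : ℝ) + 1 / 2) (by positivity),
      Real.Gamma_add_one (s := (j : ℝ) + 1) (by positivity)]
    simp only [Real.sin_pi, Real.sin_zero]
    push_cast
    field_simp
    ring

theorem integral_cos_pow_zero_pi_odd (j : ℕ) :
    ∫ θ in (0 : ℝ)..Real.pi, Real.cos θ ^ (2 * j + 1) = 0 := by
  induction j with
  | zero => simp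
  | succ j ih =>
    rw [show 2 * (j + 1) + 1 = 2 * j + 1 + 2 by ring, integral_cos_pow, ih]
    simp

/-- The moments of the Gegenbauer distribution, as products of arcsine moments and the limits
`Σ` without their powers of two. -/
theorem integral_pow_gegenbauerMeasure {α : ℝ} (hα : 0 < α) (m : ℕ) :
    ∫ x, x ^ m ∂(gegenbauerMeasure α) =
      1 / Real.pi * (∫ θ in (0 : ℝ)..Real.pi, Real.cos θ ^ m) *
        (gbinom ((α + m) / 2) (α / 2))⁻¹ := by
  rw [integral_gegenbauerMeasure hα]
  rcases Nat.even_or_odd' m with ⟨j, rfl | rfl⟩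
  · rw [integral_neg_one_one_pow_mul_rpow_even j (by linarith), gegenbauerMass_eq_beta hα,
      integral_cos_pow_zero_pi_even, ProbabilityTheory.beta, ProbabilityTheory.beta, gbinom,
      Real.Gamma_one_half_eq]
    have e1 : (α - 1) / 2 + 1 = (α + 1) / 2 := by ring
    have e2 : (j : ℝ) + 1 / 2 + (α + 1) / 2 = α / 2 + j + 1 := by ring
    have e3 : 1 / 2 + (α + 1) / 2 = α / 2 + 1 := by ring
    have e4 : (α + ((2 * j : ℕ) : ℝ)) / 2 + 1 = α / 2 + j + 1 := by push_cast; ring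
    have e5 : (α + ((2 * j : ℕ) : ℝ)) / 2 - α / 2 + 1 = j + 1 := by push_cast; ring
    rw [e1, e2, e3, e4, e5]
    have h1 : Real.Gamma ((α + 1) / 2) ≠ 0 := (Real.Gamma_pos_of_pos (by linarith)).ne'
    have h2 : Real.Gamma (α / 2 + j + 1) ≠ 0 := (Real.Gamma_pos_of_pos (by positivity)).ne'
    have h3 : Real.Gamma (α / 2 + 1) ≠ 0 := (Real.Gamma_pos_of_pos (by positivity)).ne'
    have h4 : Real.Gamma ((j : ℝ) + 1) ≠ 0 := (Real.Gamma_pos_of_pos (by positivity)).ne'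
    have h5 : Real.sqrt Real.pi ≠ 0 := (Real.sqrt_pos.2 Real.pi_pos).ne'
    have hpi : Real.sqrt Real.pi ^ 2 = Real.pi := Real.sq_sqrt Real.pi_pos.le
    have h6 := Real.pi_ne_zero
    field_simp
    rw [hpi]
  · rw [integral_neg_one_one_pow_mul_rpow_odd, integral_cos_pow_zero_pi_odd]
    simp

/-! ### Cesàro weights -/

theorem cesaroSeq_eq_Gamma (β : ℝ) (n : ℕ) :
    cesaroSeq β n = Real.Gamma (n + β) / (Real.Gamma (n + 1) * Real.Gamma β) := by
  rw [cesaroSeq, gbinom]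
  congr 2
  · ring
  · congr 1; ring_nf

theorem cesaroSeq_pos {β : ℝ} (hβ : 0 < β) (n : ℕ) : 0 < cesaroSeq β n := by
  rw [cesaroSeq_eq_Gamma]
  have h1 := Real.Gamma_pos_of_pos (s := n + β) (by positivity)
  have h2 := Real.Gamma_pos_of_pos (s := (n : ℝ) + 1) (by positivity)
  have h3 := Real.Gamma_pos_of_pos hβ
  positivity

theorem cesaroSeq_zero {β : ℝ} (hβ : 0 < β) : cesaroSeq β 0 = 1 := by
  have h3 := Real.Gamma_pos_of_pos hβ
  rw [cesaroSeq_eq_Gamma]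
  simp [h3.ne']

theorem cesaroSeq_succ {β : ℝ} (hβ : 0 < β) (n : ℕ) :
    cesaroSeq β (n + 1) = cesaroSeq β n * ((n + β) / (n + 1)) := by
  have h1 : ((n + 1 : ℕ) : ℝ) + β = (n + β) + 1 := by push_cast; ring
  have h2 := Real.Gamma_pos_of_pos (s := (n : ℝ) + 1) (by positivity)
  have h3 := Real.Gamma_pos_of_pos hβ
  rw [cesaroSeq_eq_Gamma, cesaroSeq_eq_Gamma, h1, Real.Gamma_add_one (s := n + β) (by positivity),
    Real.Gamma_add_one (s := ((n + 1 : ℕ) : ℝ)) (by positivity)]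
  push_cast
  field_simp

theorem cesaroSeq_add_one {β : ℝ} (hβ : 0 < β) (n : ℕ) :
    cesaroSeq (β + 1) n = cesaroSeq β n * ((n + β) / β) := by
  have h3 := Real.Gamma_pos_of_pos hβ
  rw [cesaroSeq_eq_Gamma, cesaroSeq_eq_Gamma, ← add_assoc,
    Real.Gamma_add_one (s := n + β) (by positivity), Real.Gamma_add_one hβ.ne']
  field_simp

theorem sum_cesaroSeq {β : ℝ} (hβ : 0 < β) (n : ℕ) :
    ∑ k ∈ Finset.range (n + 1), cesaroSeq β k = cesaroSeq (β + 1) n := by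
  induction n with
  | zero => simp [cesaroSeq_zero hβ, cesaroSeq_zero (add_pos hβ one_pos)]
  | succ n ih =>
    rw [Finset.sum_range_succ, ih, cesaroSeq_add_one hβ, cesaroSeq_add_one hβ, cesaroSeq_succ hβ]
    push_cast
    field_simp

theorem one_div_cesaroTau (α : ℝ) (n : ℕ) : 1 / cesaroTau α n = cesaroSeq (α + 1) n := by
  rw [cesaroTau, one_div_one_div, cesaroSeq, ← add_assoc, add_sub_cancel_right]

theorem cesaroWeight_eq (α : ℝ) (n k : ℕ) :
    cesaroWeight α n k = cesaroSeq α (n - k) / cesaroSeq (α + 1) n := by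
  rw [cesaroWeight, ← one_div_cesaroTau, one_div, div_inv_eq_mul, mul_comm]

theorem cesaroWeight_nonneg {α : ℝ} (hα : 0 < α) (n k : ℕ) : 0 ≤ cesaroWeight α n k := by
  rw [cesaroWeight_eq]
  exact div_nonneg (cesaroSeq_pos hα _).le (cesaroSeq_pos (by linarith) _).le

theorem sum_cesaroWeight {α : ℝ} (hα : 0 < α) (n : ℕ) :
    ∑ k ∈ Finset.range (n + 1), cesaroWeight α n k = 1 := by
  simp only [cesaroWeight_eq, ← Finset.sum_div]
  rw [Finset.sum_flip (fun k => cesaroSeq α k), sum_cesaroSeq hα,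
    div_self (cesaroSeq_pos (by linarith) _).ne']

theorem cesaroNorm_eq {α : ℝ} (hα : 0 < α) (n : ℕ) :
    cesaroNorm α n = cesaroSeq (α + 2) n / cesaroSeq (α + 1) n := by
  have hα1 : 0 < α + 1 := by linarith
  rw [cesaroNorm]
  simp only [one_div_cesaroTau]
  rw [sum_cesaroSeq hα1, ← one_div_cesaroTau α, one_div, div_inv_eq_mul, mul_comm,
    show α + 1 + 1 = α + 2 by ring]

theorem cesaroNorm_pos {α : ℝ} (hα : 0 < α) (n : ℕ) : 0 < cesaroNorm α n := by
  rw [cesaroNorm_eq hα]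
  exact div_pos (cesaroSeq_pos (by linarith) _) (cesaroSeq_pos (by linarith) _)

theorem tendsto_cesaroNorm_atTop {α : ℝ} (hα : 0 < α) :
    Tendsto (cesaroNorm α) atTop atTop := by
  have hα1 : 0 < α + 1 := by linarith
  have e : cesaroNorm α = fun n : ℕ => ((n : ℝ) + (α + 1)) / (α + 1) := by
    funext n
    rw [cesaroNorm_eq hα, show α + 2 = (α + 1) + 1 by ring, cesaroSeq_add_one hα1,
      mul_div_cancel_left₀ _ (cesaroSeq_pos hα1 n).ne']
  rw [e]
  exact (tendsto_atTop_add_const_right _ _ tendsto_natCast_atTop_atTop).atTop_div_const hα1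

theorem monotone_cesaroSeq_add_one {α : ℝ} (hα : 0 < α) : Monotone (cesaroSeq (α + 1)) := by
  refine monotone_nat_of_le_succ fun n => ?_
  rw [← sum_cesaroSeq hα, ← sum_cesaroSeq hα, Finset.sum_range_succ _ (n + 1)]
  linarith [cesaroSeq_pos hα (n + 1)]

theorem tendsto_cesaroWeight_zero {α : ℝ} (hα : 0 < α) (k : ℕ) :
    Tendsto (fun n => cesaroWeight α n k) atTop (𝓝 0) := by
  rw [← tendsto_add_atTop_iff_nat k]
  have hlim : Tendsto (fun n : ℕ => α / ((n : ℝ) + α)) atTop (𝓝 0) :=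
    (tendsto_atTop_add_const_right _ _ tendsto_natCast_atTop_atTop).const_div_atTop α
  refine squeeze_zero (fun n => cesaroWeight_nonneg hα _ _) (fun n => ?_) hlim
  rw [cesaroWeight_eq, Nat.add_sub_cancel]
  have h1 := cesaroSeq_pos hα n
  have hα1 : 0 < α + 1 := by linarith
  calc _ ≤ cesaroSeq α n / cesaroSeq (α + 1) n :=
        div_le_div_of_nonneg_left h1.le (cesaroSeq_pos hα1 n)
          (monotone_cesaroSeq_add_one hα (Nat.le_add_right n k))
    _ = _ := by
        rw [cesaroSeq_add_one hα]
        field_simp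

theorem tendsto_cesaroSeq_div_shift {α : ℝ} (hα : 0 < α) (m : ℕ) :
    Tendsto (fun n => cesaroSeq (α + 1) n / cesaroSeq (α + 1) (n + m)) atTop (𝓝 1) := by
  have hα1 : 0 < α + 1 := by linarith
  induction m with
  | zero => simp [div_self (cesaroSeq_pos hα1 _).ne']
  | succ m ih =>
    -- with `C = cesaroSeq (α + 1)`, one step of the shift is `C_N / C_{N+1} = 1 - σ_{N+1,0}`
    have h1 : Tendsto (fun n => 1 - cesaroWeight α (n + (m + 1)) 0) atTop (𝓝 (1 - 0)) :=
      (((tendsto_add_atTop_iff_nat (m + 1)).2 (tendsto_cesaroWeight_zero hα 0))).const_sub 1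
    have h2 := ih.mul h1
    rw [sub_zero, mul_one] at h2
    refine h2.congr fun n => ?_
    have hs : cesaroSeq (α + 1) (n + (m + 1)) =
        cesaroSeq (α + 1) (n + m) + cesaroSeq α (n + (m + 1)) := by
      rw [← sum_cesaroSeq hα, ← sum_cesaroSeq hα, ← add_assoc, Finset.sum_range_succ _ (n + m + 1)]
    have p1 := cesaroSeq_pos hα1 (n + m)
    have p2 := cesaroSeq_pos hα1 (n + (m + 1))
    rw [cesaroWeight_eq, Nat.sub_zero, eq_sub_of_add_eq' hs.symm]
    field_simp
    ring

/-- Cesàro means along the antidiagonals do not see a shift of the inner index, because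
`σ_{n+m,k+m}` and `σ_{n,k}` have asymptotic ratio one and the weights of the first `m` terms
vanish in the limit. -/
theorem tendsto_cesaroMean_of_shift {α : ℝ} (hα : 0 < α) {F : ℕ → ℕ → ℝ} {K L : ℝ}
    (hF : ∀ j k, |F j k| ≤ K) (m : ℕ)
    (h : Tendsto (fun n => ∑ k ∈ Finset.range (n + 1), cesaroWeight α n k * F (n - k) (k + m))
      atTop (𝓝 L)) :
    Tendsto (fun n => ∑ k ∈ Finset.range (n + 1), cesaroWeight α n k * F (n - k) k)
      atTop (𝓝 L) := by
  rw [← tendsto_add_atTop_iff_nat m]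
  have h1 : Tendsto (fun n => ∑ k ∈ Finset.range m, cesaroWeight α (n + m) k * F (n + m - k) k)
      atTop (𝓝 (∑ _ ∈ Finset.range m, 0)) := by
    refine tendsto_finsetSum _ fun k _ => ?_
    have h2 := (tendsto_add_atTop_iff_nat m).2 (tendsto_cesaroWeight_zero hα k)
    exact h2.zero_mul_isBoundedUnder_le (isBoundedUnder_of ⟨K, fun n => hF _ _⟩)
  have h3 := h1.add ((tendsto_cesaroSeq_div_shift hα m).mul h)
  rw [Finset.sum_const_zero, zero_add, one_mul] at h3
  refine h3.congr fun n => ?_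
  rw [show n + m + 1 = m + (n + 1) by ring, Finset.sum_range_add _ m (n + 1), Finset.mul_sum]
  congr 1
  refine Finset.sum_congr rfl fun k _ => ?_
  have p1 := cesaroSeq_pos (by linarith : 0 < α + 1) n
  rw [cesaroWeight_eq, cesaroWeight_eq, show n + m - (m + k) = n - k by omega, add_comm m k]
  field_simp

/-- Cesàro means of the inner partial sums are weighted averages of the Cesàro means. -/
theorem sum_cesaroSeq_mul_partialSum (c : ℕ → ℝ) (F : ℕ → ℕ → ℝ) (n : ℕ) :
    ∑ k ∈ Finset.range (n + 1), c (n - k) * ∑ i ∈ Finset.range (k + 1), F (n - k) i =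
      ∑ s ∈ Finset.range (n + 1), ∑ k ∈ Finset.range (s + 1), c (s - k) * F (s - k) k := by
  have e1 : ∀ k ∈ Finset.range (n + 1),
      c (n - k) * ∑ i ∈ Finset.range (k + 1), F (n - k) i =
        ∑ s ∈ Finset.Ico (n - k) (n + 1), c (n - k) * F (n - k) (s - (n - k)) := by
    intro k hk
    have hk' := Finset.mem_range.1 hk
    rw [Finset.mul_sum, Finset.sum_Ico_eq_sum_range, show n + 1 - (n - k) = k + 1 by omega]
    simp only [Nat.add_sub_cancel_left]
  rw [Finset.sum_congr rfl e1, Finset.sum_flip (fun j =>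
    ∑ s ∈ Finset.Ico j (n + 1), c j * F j (s - j)), Finset.sum_comm' (t' := Finset.range (n + 1))
      (s' := fun s => Finset.range (s + 1)) (by
        intro j s
        simp only [Finset.mem_range, Finset.mem_Ico]
        omega)]
  refine Finset.sum_congr rfl fun s _ => ?_
  rw [← Finset.sum_flip (fun j => c j * F j (s - j))]
  refine Finset.sum_congr rfl fun k hk => ?_
  rw [Nat.sub_sub_self (Nat.lt_succ_iff.1 (Finset.mem_range.1 hk))]

/-- A weighted average of a convergent sequence converges, if the total weight diverges. -/
theorem tendsto_weighted_average {w M : ℕ → ℝ} {L : ℝ} (hw : ∀ n, 1 ≤ w n)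
    (hM : Tendsto M atTop (𝓝 L)) :
    Tendsto (fun n => (∑ s ∈ Finset.range (n + 1), w s * M s) / ∑ s ∈ Finset.range (n + 1), w s)
      atTop (𝓝 L) := by
  have hpos : ∀ n : ℕ, (n : ℝ) ≤ ∑ s ∈ Finset.range n, w s := fun n => by
    have := Finset.sum_le_sum (s := Finset.range n) fun s _ => hw s
    simpa using this
  have h1 : (fun s => w s * (M s - L)) =o[atTop] w := by
    have h2 : (fun s => M s - L) =o[atTop] fun _ => (1 : ℝ) :=
      (Asymptotics.isLittleO_one_iff ℝ).2 (by simpa using hM.sub_const L)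
    simpa using (Asymptotics.isBigO_refl w atTop).mul_isLittleO h2
  have h3 := h1.sum_range (fun n => zero_le_one.trans (hw n))
    (tendsto_atTop_mono hpos tendsto_natCast_atTop_atTop)
  have h4 := (h3.tendsto_div_nhds_zero.comp (tendsto_add_atTop_nat 1)).add_const L
  rw [zero_add] at h4
  refine h4.congr fun n => ?_
  have p : 0 < ∑ s ∈ Finset.range (n + 1), w s :=
    lt_of_lt_of_le (by exact_mod_cast n.succ_pos) (hpos (n + 1))
  simp only [Function.comp_apply, mul_sub, Finset.sum_sub_distrib, ← Finset.sum_mul]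
  field_simp
  ring

/-! ### Comparison with constant recurrence coefficients -/

/-- The matrix element of the `m`-th power of the two-sided Jacobi operator with constant
coefficients `a`, `b`, between basis vectors at distance `j`: a Fourier coefficient of the
`m`-th power of its symbol `a + 2 b cos θ`. -/
def toeplitzMoment (m : ℕ) (j : ℤ) (a b : ℝ) : ℝ :=
  1 / Real.pi * ∫ θ in (0 : ℝ)..Real.pi, (a + 2 * b * Real.cos θ) ^ m * Real.cos (j * θ)

theorem toeplitzMoment_zero (j : ℤ) (a b : ℝ) :
    toeplitzMoment 0 j a b = if j = 0 then 1 else 0 := by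
  simp only [toeplitzMoment, pow_zero, one_mul]
  split_ifs with hj
  · subst hj
    simp [Real.pi_ne_zero]
  · rw [intervalIntegral.integral_comp_mul_left (fun x => Real.cos x) (Int.cast_ne_zero.2 hj),
      integral_cos, Real.sin_int_mul_pi]
    simp

theorem toeplitzMoment_succ (m : ℕ) (j : ℤ) (a b : ℝ) :
    toeplitzMoment (m + 1) j a b = b * toeplitzMoment m (j + 1) a b + a * toeplitzMoment m j a b +
      b * toeplitzMoment m (j - 1) a b := by
  have e : ∀ θ : ℝ, (a + 2 * b * Real.cos θ) ^ (m + 1) * Real.cos (j * θ) =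
      b * ((a + 2 * b * Real.cos θ) ^ m * Real.cos ((j + 1 : ℤ) * θ)) +
      a * ((a + 2 * b * Real.cos θ) ^ m * Real.cos (j * θ)) +
      b * ((a + 2 * b * Real.cos θ) ^ m * Real.cos ((j - 1 : ℤ) * θ)) := by
    intro θ
    push_cast
    rw [add_mul, sub_mul, one_mul, Real.cos_add, Real.cos_sub]
    ring
  simp only [toeplitzMoment, e]
  rw [intervalIntegral.integral_add, intervalIntegral.integral_add,
    intervalIntegral.integral_const_mul, intervalIntegral.integral_const_mul,
    intervalIntegral.integral_const_mul]
  · ring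
  all_goals exact Continuous.intervalIntegrable (by fun_prop) _ _

theorem abs_toeplitzMoment_le {A B a b : ℝ} (ha : |a| ≤ A) (hb : |b| ≤ B) (m : ℕ) (j : ℤ) :
    |toeplitzMoment m j a b| ≤ (A + 2 * B) ^ m := by
  have h1 : ‖∫ θ in (0 : ℝ)..Real.pi, (a + 2 * b * Real.cos θ) ^ m * Real.cos (j * θ)‖ ≤
      (A + 2 * B) ^ m * |Real.pi - 0| := by
    refine intervalIntegral.norm_integral_le_of_norm_le_const fun θ _ => ?_
    rw [Real.norm_eq_abs, abs_mul, abs_pow]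
    have h2 : |a + 2 * b * Real.cos θ| ≤ A + 2 * B := by
      refine (abs_add_le _ _).trans ?_
      rw [abs_mul, abs_mul, abs_two]
      have := mul_le_mul hb (Real.abs_cos_le_one θ) (abs_nonneg _) ((abs_nonneg _).trans hb)
      linarith
    have h3 := pow_le_pow_left₀ (abs_nonneg _) h2 m
    calc _ ≤ |a + 2 * b * Real.cos θ| ^ m * 1 := by
          gcongr
          exact Real.abs_cos_le_one _
      _ ≤ _ := by rwa [mul_one]
  rw [Real.norm_eq_abs, sub_zero, abs_of_pos Real.pi_pos] at h1
  rw [toeplitzMoment, abs_mul, abs_of_pos (by positivity : 0 < 1 / Real.pi), one_div,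
    inv_mul_le_iff₀ Real.pi_pos]
  linarith

theorem toeplitzMoment_diag (m : ℕ) (a b : ℝ) :
    toeplitzMoment m 0 a b = ∑ r ∈ Finset.range (m + 1), (m.choose r * 2 ^ (m - r) *
      (1 / Real.pi * ∫ θ in (0 : ℝ)..Real.pi, Real.cos θ ^ (m - r))) * (a ^ r * b ^ (m - r)) := by
  simp only [toeplitzMoment, Int.cast_zero, zero_mul, Real.cos_zero, mul_one, add_pow]
  rw [intervalIntegral.integral_finsetSum
    fun r _ => Continuous.intervalIntegrable (by fun_prop) _ _, Finset.mul_sum]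
  refine Finset.sum_congr rfl fun r _ => ?_
  have e : ∀ θ : ℝ, a ^ r * (2 * b * Real.cos θ) ^ (m - r) * (m.choose r : ℝ) =
      (a ^ r * b ^ (m - r) * 2 ^ (m - r) * m.choose r) * Real.cos θ ^ (m - r) := by
    intro θ
    rw [mul_pow, mul_pow]; ring
  simp only [e, intervalIntegral.integral_const_mul]
  ring

/-- The matrix elements of the powers of a Jacobi operator, compared with those for the
coefficients frozen at index `k`. The condition `m ≤ i` keeps the recurrence away from index
zero. -/
theorem abs_jacobiMoment_sub_toeplitzMoment_le {μ : Measure ℝ} (h : IsOrthogonalityMeasure μ)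
    {A B : ℝ} (hA : ∀ n, |jacobiA μ n| ≤ A) (hB : ∀ n, |jacobiB μ n| ≤ B) (k L j m i : ℕ)
    (hi : m ≤ i) (hL : i + m ≤ L) :
    |jacobiMoment μ m (k + i) (k + j) - toeplitzMoment m (i - j) (jacobiA μ k) (jacobiB μ k)| ≤
      3 * m * (A + 2 * B + 1) ^ m * ∑ l ∈ Finset.range (L + 1),
        (|jacobiA μ (k + l) - jacobiA μ k| + |jacobiB μ (k + l) - jacobiB μ k|) := by
  have hA0 : 0 ≤ A := (abs_nonneg _).trans (hA 0)
  have hB0 : 0 ≤ B := (abs_nonneg _).trans (hB 0)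
  set D := ∑ l ∈ Finset.range (L + 1),
    (|jacobiA μ (k + l) - jacobiA μ k| + |jacobiB μ (k + l) - jacobiB μ k|) with hD
  have hD0 : 0 ≤ D := Finset.sum_nonneg fun l _ => by positivity
  have hterm : ∀ l ≤ L, |jacobiA μ (k + l) - jacobiA μ k| + |jacobiB μ (k + l) - jacobiB μ k| ≤ D :=
    fun l hl => Finset.single_le_sum
      (f := fun l => |jacobiA μ (k + l) - jacobiA μ k| + |jacobiB μ (k + l) - jacobiB μ k|)
      (fun l _ => by positivity) (Finset.mem_range.2 (Nat.lt_succ_of_le hl))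
  have hDa : ∀ l ≤ L, |jacobiA μ (k + l) - jacobiA μ k| ≤ D := fun l hl =>
    (le_add_of_nonneg_right (abs_nonneg _)).trans (hterm l hl)
  have hDb : ∀ l ≤ L, |jacobiB μ (k + l) - jacobiB μ k| ≤ D := fun l hl =>
    (le_add_of_nonneg_left (abs_nonneg _)).trans (hterm l hl)
  clear_value D
  induction m generalizing i with
  | zero =>
    rw [jacobiMoment_zero h, toeplitzMoment_zero]
    have : ((i : ℤ) - j = 0) ↔ k + i = k + j := by omega
    simp only [this]
    simp
  | succ m ih =>
    obtain ⟨i, rfl⟩ : ∃ i', i = i' + 1 := ⟨i - 1, by omega⟩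
    set ρ := A + 2 * B + 1 with hρ
    have hρ1 : 1 ≤ ρ := by linarith
    have hT : ∀ d : ℤ, |toeplitzMoment m d (jacobiA μ k) (jacobiB μ k)| ≤ ρ ^ m := fun d =>
      (abs_toeplitzMoment_le (hA k) (hB k) m d).trans
        (pow_le_pow_left₀ (by positivity) (by linarith) _)
    -- `u s - v t = u (s - t) + (u - v) t`, used for each of the three terms of the recurrence
    have hstep : ∀ {u v s t c : ℝ}, |u| ≤ c → |u - v| ≤ D → |s - t| ≤ 3 * m * ρ ^ m * D →
        |t| ≤ ρ ^ m → |u * s - v * t| ≤ c * (3 * m * ρ ^ m * D) + ρ ^ m * D := by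
      intro u v s t c h1 h2 h3 h4
      have e : u * s - v * t = u * (s - t) + (u - v) * t := by ring
      rw [e]
      refine (abs_add_le _ _).trans ?_
      rw [abs_mul, abs_mul, mul_comm (ρ ^ m) D]
      have := (abs_nonneg u).trans h1
      gcongr
    have s1 := hstep (hB (k + (i + 1 + 1))) (hDb (i + 1 + 1) (by omega))
      (ih (i + 1 + 1) (by omega) (by omega)) (hT _)
    have s2 := hstep (hA (k + (i + 1))) (hDa (i + 1) (by omega))
      (ih (i + 1) (by omega) (by omega)) (hT _)
    have s3 := hstep (hB (k + (i + 1))) (hDb (i + 1) (by omega))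
      (ih i (by omega) (by omega)) (hT _)
    rw [jacobiMoment_succ h, toeplitzMoment_succ, show k + (i + 1) - 1 = k + i by omega,
      show k + (i + 1) + 1 = k + (i + 1 + 1) by ring,
      show ((i + 1 : ℕ) : ℤ) - j + 1 = ((i + 1 + 1 : ℕ) : ℤ) - j by push_cast; ring,
      show ((i + 1 : ℕ) : ℤ) - j - 1 = (i : ℤ) - j by push_cast; ring]
    have htri : ∀ x y z x' y' z' : ℝ, |x + y + z - (x' + y' + z')| ≤
        |x - x'| + |y - y'| + |z - z'| := fun x y z x' y' z' => by
      rw [show x + y + z - (x' + y' + z') = (x - x') + (y - y') + (z - z') by ring]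
      exact abs_add_three _ _ _
    refine (htri _ _ _ _ _ _).trans ((add_le_add (add_le_add s1 s2) s3).trans ?_)
    have hX : 0 ≤ ρ ^ m * D := by positivity
    have hmX : 0 ≤ 3 * (m : ℝ) * ρ ^ m * D := by positivity
    calc _ = (A + 2 * B) * (3 * m * ρ ^ m * D) + 3 * (ρ ^ m * D) := by ring
      _ ≤ ρ * (3 * m * ρ ^ m * D) + 3 * (ρ * (ρ ^ m * D)) := by
          refine add_le_add (mul_le_mul_of_nonneg_right (by linarith) hmX) ?_
          exact mul_le_mul_of_nonneg_left (le_mul_of_one_le_left hX hρ1) (by norm_num)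
      _ = _ := by push_cast; ring

/-! ### Limits of the mean moments -/

/-- The limit values `Σ_{l_a,l_b}` that single out the Gegenbauer distribution. -/
def cesaroLimit (α : ℝ) (la lb : ℕ) : ℝ :=
  (if la = 0 then 1 else 0) * (2 : ℝ)⁻¹ ^ lb * (gbinom ((α + lb) / 2) (α / 2))⁻¹

section moments

variable {α : ℝ} {μ : ℕ → Measure ℝ}

/-- Only the terms without a diagonal coefficient survive in the mean of
`toeplitzMoment m 0 a b`; they are arcsine moments. -/
theorem tendsto_mean_toeplitzMoment (hα : 0 < α)
    (hclass : InMeanNevaiClass (cesaroWeight α) μ (cesaroLimit α)) (m : ℕ) :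
    Tendsto (fun n => ∑ k ∈ Finset.range (n + 1), cesaroWeight α n k *
      toeplitzMoment m 0 (jacobiA (μ (n - k)) k) (jacobiB (μ (n - k)) k)) atTop
      (𝓝 (∫ x, x ^ m ∂(gegenbauerMeasure α))) := by
  have h1 := tendsto_finsetSum (Finset.range (m + 1)) fun r _ =>
    (hclass.limits r (m - r)).const_mul (m.choose r * 2 ^ (m - r) *
      (1 / Real.pi * ∫ θ in (0 : ℝ)..Real.pi, Real.cos θ ^ (m - r)))
  have e : ∑ r ∈ Finset.range (m + 1), (m.choose r * 2 ^ (m - r) *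
      (1 / Real.pi * ∫ θ in (0 : ℝ)..Real.pi, Real.cos θ ^ (m - r))) * cesaroLimit α r (m - r) =
      ∫ x, x ^ m ∂(gegenbauerMeasure α) := by
    rw [Finset.sum_eq_single 0]
    · rw [integral_pow_gegenbauerMeasure hα, cesaroLimit]
      simp only [Nat.choose_zero_right, Nat.sub_zero, if_true, Nat.cast_one, one_mul]
      have : (2 : ℝ) ^ m * 2⁻¹ ^ m = 1 := by rw [← mul_pow]; norm_num
      linear_combination (1 / Real.pi * (∫ θ in (0 : ℝ)..Real.pi, Real.cos θ ^ m) *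
        (gbinom ((α + m) / 2) (α / 2))⁻¹) * this
    · intro r _ hr
      simp [cesaroLimit, hr]
    · simp
  rw [e] at h1
  refine h1.congr fun n => ?_
  simp only [toeplitzMoment_diag, Finset.mul_sum]
  rw [Finset.sum_comm]
  refine Finset.sum_congr rfl fun k _ => Finset.sum_congr rfl fun r _ => ?_
  ring

theorem tendsto_mean_jacobiMoment (hα : 0 < α) (hμ : ∀ k, IsOrthogonalityMeasure (μ k))
    (hclass : InMeanNevaiClass (cesaroWeight α) μ (cesaroLimit α)) (m : ℕ) :
    Tendsto (fun n => ∑ k ∈ Finset.range (n + 1), cesaroWeight α n k *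
      jacobiMoment (μ (n - k)) m k k) atTop (𝓝 (∫ x, x ^ m ∂(gegenbauerMeasure α))) := by
  obtain ⟨A, hA⟩ := hclass.bounded_a
  obtain ⟨B, hB⟩ := hclass.bounded_b
  refine tendsto_cesaroMean_of_shift hα (F := fun j k => jacobiMoment (μ j) m k k)
    (fun j k => abs_jacobiMoment_le (hμ j) (fun n => hA n j) (fun n => hB n j) m k k) m ?_
  have h0 := tendsto_finsetSum (Finset.range (2 * m + 1)) fun l _ =>
    (hclass.shift_a l).add (hclass.shift_b l)
  have h1 := h0.const_mul (3 * m * (A + 2 * B + 1) ^ m)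
  simp only [add_zero, Finset.sum_const_zero, mul_zero] at h1
  have h2 : Tendsto (fun n => ∑ k ∈ Finset.range (n + 1), cesaroWeight α n k *
      (jacobiMoment (μ (n - k)) m (k + m) (k + m) -
        toeplitzMoment m 0 (jacobiA (μ (n - k)) k) (jacobiB (μ (n - k)) k))) atTop (𝓝 0) := by
    refine squeeze_zero_norm (fun n => ?_) h1
    refine (norm_sum_le _ _).trans ?_
    have e : ∀ x y : ℕ → ℕ → ℝ, 3 * m * (A + 2 * B + 1) ^ m * ∑ l ∈ Finset.range (2 * m + 1),
        (∑ k ∈ Finset.range (n + 1), cesaroWeight α n k * x l k +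
          ∑ k ∈ Finset.range (n + 1), cesaroWeight α n k * y l k) =
        ∑ k ∈ Finset.range (n + 1), cesaroWeight α n k * (3 * m * (A + 2 * B + 1) ^ m *
          ∑ l ∈ Finset.range (2 * m + 1), (x l k + y l k)) := by
      intro x y
      simp only [← Finset.sum_add_distrib, Finset.mul_sum]
      rw [Finset.sum_comm]
      refine Finset.sum_congr rfl fun k _ => Finset.sum_congr rfl fun l _ => ?_
      ring
    rw [e]
    refine Finset.sum_le_sum fun k _ => ?_
    rw [norm_mul, Real.norm_of_nonneg (cesaroWeight_nonneg hα n k)]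
    refine mul_le_mul_of_nonneg_left ?_ (cesaroWeight_nonneg hα n k)
    have := abs_jacobiMoment_sub_toeplitzMoment_le (hμ (n - k)) (fun i => hA i _)
      (fun i => hB i _) k (2 * m) m m m le_rfl (by omega)
    rwa [sub_self] at this
  have h3 := h2.add (tendsto_mean_toeplitzMoment hα hclass m)
  rw [zero_add] at h3
  refine h3.congr fun n => ?_
  rw [← Finset.sum_add_distrib]
  refine Finset.sum_congr rfl fun k _ => ?_
  ring

end moments

/-! ### The mean measures as finite sums -/

section sums

variable {ι : Type*} {s : Finset ι} {c : ι → ℝ} {ρ : ι → Measure ℝ}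

theorem isFiniteMeasure_sum_smul (hρ : ∀ i ∈ s, IsFiniteMeasure (ρ i)) :
    IsFiniteMeasure (∑ i ∈ s, ENNReal.ofReal (c i) • ρ i) := by
  refine ⟨?_⟩
  rw [Measure.finsetSum_apply]
  refine ENNReal.sum_lt_top.2 fun i hi => ?_
  have := hρ i hi
  rw [Measure.smul_apply, smul_eq_mul]
  exact ENNReal.mul_lt_top ENNReal.ofReal_lt_top (measure_lt_top _ _)

theorem ae_sum_smul {p : ℝ → Prop} (hp : ∀ i ∈ s, ∀ᵐ x ∂(ρ i), p x) :
    ∀ᵐ x ∂(∑ i ∈ s, ENNReal.ofReal (c i) • ρ i), p x := by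
  rw [ae_iff, Measure.finsetSum_apply]
  refine Finset.sum_eq_zero fun i hi => ?_
  rw [Measure.smul_apply, ae_iff.1 (hp i hi), smul_zero]

theorem integral_sum_smul (hc : ∀ i ∈ s, 0 ≤ c i) {f : ℝ → ℝ}
    (hf : ∀ i ∈ s, Integrable f (ρ i)) :
    ∫ x, f x ∂(∑ i ∈ s, ENNReal.ofReal (c i) • ρ i) = ∑ i ∈ s, c i * ∫ x, f x ∂(ρ i) := by
  rw [integral_finsetSum_measure fun i hi => (hf i hi).smul_measure ENNReal.ofReal_ne_top]
  refine Finset.sum_congr rfl fun i hi => ?_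
  rw [integral_smul_measure, ENNReal.toReal_ofReal (hc i hi), smul_eq_mul]

end sums

section density

variable {ρ : Measure ℝ} {d : ℝ → ℝ}

theorem isFiniteMeasure_withDensity_polynomial (h : IsOrthogonalityMeasure ρ) (q : ℝ[X]) :
    IsFiniteMeasure (ρ.withDensity fun x => ENNReal.ofReal (q.eval x)) := by
  refine isFiniteMeasure_withDensity_ofReal ?_
  have := integrable_poly h q 1
  simp only [eval_one, mul_one] at this
  exact this.2

theorem integral_withDensity_ofReal (hd : Continuous d) (hd0 : ∀ x, 0 ≤ d x) (f : ℝ → ℝ) :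
    ∫ x, f x ∂(ρ.withDensity fun x => ENNReal.ofReal (d x)) = ∫ x, f x * d x ∂ρ := by
  rw [integral_withDensity_eq_integral_toReal_smul (by fun_prop)
    (ae_of_all _ fun _ => ENNReal.ofReal_lt_top)]
  refine integral_congr_ae (ae_of_all _ fun x => ?_)
  simp only [ENNReal.toReal_ofReal (hd0 x), smul_eq_mul, mul_comm]

end density

/-- The Christoffel-Darboux kernel on the diagonal, as a polynomial. -/
def cdPoly (μ : Measure ℝ) (n : ℕ) : ℝ[X] := ∑ l ∈ Finset.range (n + 1), orthoPoly μ l ^ 2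

theorem eval_cdPoly (μ : Measure ℝ) (n : ℕ) (x : ℝ) : (cdPoly μ n).eval x = cdKernel μ n x x := by
  simp only [cdPoly, cdKernel, eval_finsetSum, sq, eval_mul]

theorem continuous_cdKernel_self (μ : Measure ℝ) (n : ℕ) :
    Continuous fun x => cdKernel μ n x x := by
  simp only [← eval_cdPoly]
  exact (cdPoly μ n).continuous

theorem cdKernel_self_nonneg (μ : Measure ℝ) (n : ℕ) (x : ℝ) : 0 ≤ cdKernel μ n x x :=
  Finset.sum_nonneg fun _ _ => mul_self_nonneg _

theorem isFiniteMeasure_orthoPoly_sq {ρ : Measure ℝ} (h : IsOrthogonalityMeasure ρ) (k : ℕ) :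
    IsFiniteMeasure (ρ.withDensity fun x => ENNReal.ofReal ((orthoPoly ρ k).eval x ^ 2)) := by
  have := isFiniteMeasure_withDensity_polynomial h (orthoPoly ρ k ^ 2)
  simp only [eval_pow] at this
  exact this

theorem isFiniteMeasure_cdKernel {ρ : Measure ℝ} (h : IsOrthogonalityMeasure ρ) (k : ℕ) :
    IsFiniteMeasure (ρ.withDensity fun x => ENNReal.ofReal (cdKernel ρ k x x)) := by
  have := isFiniteMeasure_withDensity_polynomial h (cdPoly ρ k)
  simp only [eval_cdPoly] at this
  exact this

section means

variable {α : ℝ} {μ : ℕ → Measure ℝ} {R : ℝ}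

theorem isFiniteMeasure_meanMeasure (hμ : ∀ k, IsOrthogonalityMeasure (μ k)) (σ : ℕ → ℕ → ℝ)
    (n : ℕ) : IsFiniteMeasure (meanMeasure σ μ n) :=
  isFiniteMeasure_sum_smul fun _ _ => isFiniteMeasure_orthoPoly_sq (hμ _) _

theorem isFiniteMeasure_cdMeanMeasure (hμ : ∀ k, IsOrthogonalityMeasure (μ k)) (σ : ℕ → ℕ → ℝ)
    (N : ℕ → ℝ) (n : ℕ) : IsFiniteMeasure (cdMeanMeasure σ N μ n) :=
  isFiniteMeasure_sum_smul fun _ _ => isFiniteMeasure_cdKernel (hμ _) _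

theorem isFiniteMeasure_sum_dirac (s : Finset ℝ) :
    IsFiniteMeasure (∑ x ∈ s, Measure.dirac x) := by
  refine ⟨?_⟩
  rw [Measure.finsetSum_apply]
  exact ENNReal.sum_lt_top.2 fun i _ => measure_lt_top _ _

theorem isFiniteMeasure_zeroMeanMeasure (σ : ℕ → ℕ → ℝ) (N : ℕ → ℝ) (n : ℕ) :
    IsFiniteMeasure (zeroMeanMeasure σ N μ n) :=
  isFiniteMeasure_sum_smul fun _ _ => isFiniteMeasure_sum_dirac _

theorem ae_meanMeasure {p : ℝ → Prop} (hp : ∀ j, ∀ᵐ x ∂(μ j), p x) (σ : ℕ → ℕ → ℝ) (n : ℕ) :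
    ∀ᵐ x ∂(meanMeasure σ μ n), p x :=
  ae_sum_smul fun _ _ => (withDensity_absolutelyContinuous _ _).ae_le (hp _)

theorem ae_abs_le_zeroMeanMeasure (hμ : ∀ k, IsOrthogonalityMeasure (μ k))
    (hR : ∀ j, ∀ᵐ x ∂(μ j), |x| ≤ R) (σ : ℕ → ℕ → ℝ) (N : ℕ → ℝ) (n : ℕ) :
    ∀ᵐ x ∂(zeroMeanMeasure σ N μ n), |x| ≤ R := by
  refine ae_sum_smul fun k _ => ?_
  rw [ae_iff, Measure.finsetSum_apply]
  refine Finset.sum_eq_zero fun x hx => ?_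
  rw [← ae_iff, ae_dirac_eq]
  exact abs_le_of_mem_zeros (hμ _) (hR _) hx

theorem integral_meanMeasure (hα : 0 < α) {f : ℝ → ℝ} {n : ℕ} (hf : ∀ k, Integrable f
      ((μ (n - k)).withDensity fun x => ENNReal.ofReal ((orthoPoly (μ (n - k)) k).eval x ^ 2))) :
    ∫ x, f x ∂(meanMeasure (cesaroWeight α) μ n) = ∑ k ∈ Finset.range (n + 1),
      cesaroWeight α n k * ∫ x, f x * (orthoPoly (μ (n - k)) k).eval x ^ 2 ∂(μ (n - k)) := by
  rw [meanMeasure, integral_sum_smul (fun k _ => cesaroWeight_nonneg hα n k) fun k _ => hf k]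
  refine Finset.sum_congr rfl fun k _ => ?_
  rw [integral_withDensity_ofReal (by fun_prop) fun x => sq_nonneg _]

theorem integral_cdMeanMeasure (hα : 0 < α) {f : ℝ → ℝ} {n : ℕ} (hf : ∀ k, Integrable f
      ((μ (n - k)).withDensity fun x => ENNReal.ofReal (cdKernel (μ (n - k)) k x x))) :
    ∫ x, f x ∂(cdMeanMeasure (cesaroWeight α) (cesaroNorm α) μ n) =
      ∑ k ∈ Finset.range (n + 1), cesaroWeight α n k / cesaroNorm α n *
        ∫ x, f x * cdKernel (μ (n - k)) k x x ∂(μ (n - k)) := by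
  rw [cdMeanMeasure, integral_sum_smul (fun k _ =>
    div_nonneg (cesaroWeight_nonneg hα n k) (cesaroNorm_pos hα n).le) fun k _ => hf k]
  refine Finset.sum_congr rfl fun k _ => ?_
  rw [integral_withDensity_ofReal (continuous_cdKernel_self _ _) (cdKernel_self_nonneg _ _)]

theorem integral_zeroMeanMeasure (hα : 0 < α) (f : ℝ → ℝ) (n : ℕ) :
    ∫ x, f x ∂(zeroMeanMeasure (cesaroWeight α) (cesaroNorm α) μ n) =
      ∑ k ∈ Finset.range (n + 1), cesaroWeight α n k / cesaroNorm α n *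
        ∑ x ∈ zeros (μ (n - k)) (k + 1), f x := by
  have hi : ∀ x, Integrable f (Measure.dirac x) := fun x => integrable_dirac (by simp)
  rw [zeroMeanMeasure, integral_sum_smul (fun k _ =>
    div_nonneg (cesaroWeight_nonneg hα n k) (cesaroNorm_pos hα n).le)
    fun k _ => integrable_finsetSum_measure.2 fun x _ => hi x]
  refine Finset.sum_congr rfl fun k _ => ?_
  rw [integral_finsetSum_measure fun x _ => hi x]
  simp only [integral_dirac]

/-! ### Weak limits -/

theorem exists_ae_abs_le (hμ : ∀ k, IsOrthogonalityMeasure (μ k)) {S : ℕ → ℕ → ℝ}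
    {σ : ℕ → ℕ → ℝ} (hclass : InMeanNevaiClass σ μ S) :
    ∃ R : ℝ, 1 ≤ R ∧ ∀ j, ∀ᵐ x ∂(μ j), |x| ≤ R := by
  obtain ⟨A, hA⟩ := hclass.bounded_a
  obtain ⟨B, hB⟩ := hclass.bounded_b
  have hA0 : 0 ≤ A := (abs_nonneg _).trans (hA 0 0)
  have hB0 : 0 ≤ B := (abs_nonneg _).trans (hB 0 0)
  exact ⟨A + 2 * B + 1, by linarith, fun j => ae_abs_le (hμ j) (fun n => hA n j) fun n => hB n j⟩

theorem tendstoWeakly_meanMeasure (hα : 0 < α) (hμ : ∀ k, IsOrthogonalityMeasure (μ k))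
    (hclass : InMeanNevaiClass (cesaroWeight α) μ (cesaroLimit α)) :
    TendstoWeakly (meanMeasure (cesaroWeight α) μ) (gegenbauerMeasure α) := by
  obtain ⟨R, hR1, hR⟩ := exists_ae_abs_le hμ hclass
  have := isFiniteMeasure_meanMeasure hμ (cesaroWeight α)
  have := isFiniteMeasure_gegenbauerMeasure hα
  refine tendstoWeakly_of_moments (ae_meanMeasure hR _)
    ((ae_abs_lt_one_gegenbauerMeasure α).mono fun x hx => hx.le.trans hR1) fun m => ?_
  refine (tendsto_mean_jacobiMoment hα hμ hclass m).congr fun n => ?_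
  rw [integral_meanMeasure hα fun k => ?_]
  · simp only [integral_pow_mul_orthoPoly_sq]
  · have := isFiniteMeasure_orthoPoly_sq (hμ (n - k)) k
    exact integrable_of_ae_abs_le ((withDensity_absolutelyContinuous _ _).ae_le (hR _))
      (by fun_prop)

/-- The means of the Christoffel-Darboux kernels are weighted averages of the mean measures, so
they inherit the weak limit. -/
theorem tendstoWeakly_cdMeanMeasure (hα : 0 < α) (hμ : ∀ k, IsOrthogonalityMeasure (μ k))
    (hR : ∀ j, ∀ᵐ x ∂(μ j), |x| ≤ R) {ν : Measure ℝ}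
    (hν : TendstoWeakly (meanMeasure (cesaroWeight α) μ) ν) :
    TendstoWeakly (cdMeanMeasure (cesaroWeight α) (cesaroNorm α) μ) ν := by
  intro f hf
  refine ⟨(hν f hf).1, ?_⟩
  have hα1 : 0 < α + 1 := by linarith
  have hw : ∀ n, 1 ≤ cesaroSeq (α + 1) n := fun n => by
    have := monotone_cesaroSeq_add_one hα (Nat.zero_le n)
    rwa [cesaroSeq_zero hα1] at this
  refine (tendsto_weighted_average hw (hν f hf).2).congr fun n => ?_
  have hint : ∀ j i, Integrable (fun x => f x * (orthoPoly (μ j) i).eval x ^ 2) (μ j) :=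
    fun j i => by
      have := (hμ j).finite
      exact integrable_of_ae_abs_le (hR j) (by fun_prop)
  have hK : ∀ j k, ∫ x, f x * cdKernel (μ j) k x x ∂(μ j) =
      ∑ i ∈ Finset.range (k + 1), ∫ x, f x * (orthoPoly (μ j) i).eval x ^ 2 ∂(μ j) := by
    intro j k
    rw [← integral_finsetSum _ fun i _ => hint j i]
    simp only [cdKernel, Finset.mul_sum, sq]
  rw [integral_cdMeanMeasure hα fun k => ?_]
  · simp only [hK, cesaroWeight_eq, cesaroNorm_eq hα]
    have e1 : ∀ s, cesaroSeq (α + 1) s * ∫ x, f x ∂(meanMeasure (cesaroWeight α) μ s) =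
        ∑ k ∈ Finset.range (s + 1), cesaroSeq α (s - k) *
          ∫ x, f x * (orthoPoly (μ (s - k)) k).eval x ^ 2 ∂(μ (s - k)) := by
      intro s
      rw [integral_meanMeasure hα fun k => ?_, Finset.mul_sum]
      · refine Finset.sum_congr rfl fun k _ => ?_
        have := cesaroSeq_pos hα1 s
        rw [cesaroWeight_eq]
        field_simp
      · have := isFiniteMeasure_orthoPoly_sq (hμ (s - k)) k
        exact integrable_of_ae_abs_le ((withDensity_absolutelyContinuous _ _).ae_le (hR _)) hf
    simp only [e1]
    rw [← sum_cesaroSeq_mul_partialSum (cesaroSeq α)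
      (fun j i => ∫ x, f x * (orthoPoly (μ j) i).eval x ^ 2 ∂(μ j)), sum_cesaroSeq hα1,
      show α + 1 + 1 = α + 2 by ring, Finset.sum_div]
    refine Finset.sum_congr rfl fun k _ => ?_
    have h1 := cesaroSeq_pos hα1 n
    have h2 := cesaroSeq_pos (by linarith : 0 < α + 2) n
    field_simp
  · have := isFiniteMeasure_cdKernel (hμ (n - k)) k
    exact integrable_of_ae_abs_le ((withDensity_absolutelyContinuous _ _).ae_le (hR _)) hf

theorem tendstoWeakly_zeroMeanMeasure (hα : 0 < α) (hμ : ∀ k, IsOrthogonalityMeasure (μ k))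
    {S : ℕ → ℕ → ℝ} (hclass : InMeanNevaiClass (cesaroWeight α) μ S) {ν : Measure ℝ}
    [IsFiniteMeasure ν] (hν1 : ∀ᵐ x ∂ν, |x| ≤ 1)
    (hν : TendstoWeakly (cdMeanMeasure (cesaroWeight α) (cesaroNorm α) μ) ν) :
    TendstoWeakly (zeroMeanMeasure (cesaroWeight α) (cesaroNorm α) μ) ν := by
  obtain ⟨R, hR1, hR⟩ := exists_ae_abs_le hμ hclass
  obtain ⟨A, hA⟩ := hclass.bounded_a
  obtain ⟨B, hB⟩ := hclass.bounded_b
  have := fun n => isFiniteMeasure_zeroMeanMeasure (μ := μ) (cesaroWeight α) (cesaroNorm α) n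
  refine tendstoWeakly_of_moments (ae_abs_le_zeroMeanMeasure hμ hR _ _)
    (hν1.mono fun x hx => hx.trans hR1) fun m => ?_
  have hcd := (hν (fun x => x ^ m) (by fun_prop)).2
  refine tendsto_of_tendsto_of_dist hcd ?_
  have hlim := (tendsto_cesaroNorm_atTop hα).const_div_atTop (m * (2 * (A + 2 * B + 1) ^ m))
  refine squeeze_zero (fun n => dist_nonneg) (fun n => ?_) hlim
  rw [integral_zeroMeanMeasure hα, integral_cdMeanMeasure hα fun k => ?_, dist_comm,
    Real.dist_eq, ← Finset.sum_sub_distrib]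
  · have hN := cesaroNorm_pos hα n
    refine (Finset.abs_sum_le_sum_abs _ _).trans ?_
    calc _ ≤ ∑ k ∈ Finset.range (n + 1), cesaroWeight α n k / cesaroNorm α n *
          (m * (2 * (A + 2 * B + 1) ^ m)) := by
          refine Finset.sum_le_sum fun k _ => ?_
          have hw := div_nonneg (cesaroWeight_nonneg hα n k) hN.le
          rw [← mul_sub, abs_mul, abs_of_nonneg hw]
          refine mul_le_mul_of_nonneg_left ?_ hw
          have e : ∫ x, x ^ m * cdKernel (μ (n - k)) k x x ∂(μ (n - k)) =
              ∑ i ∈ Finset.range (k + 1), jacobiMoment (μ (n - k)) m i i := by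
            simp only [← integral_pow_mul_orthoPoly_sq, cdKernel, Finset.mul_sum, ← sq]
            refine integral_finsetSum _ fun i _ => ?_
            have := (hμ (n - k)).finite
            exact integrable_of_ae_abs_le (hR _) (by fun_prop)
          rw [e]
          exact abs_sum_zeros_pow_sub_le (hμ _) (fun i => hA i _) (fun i => hB i _) k m
      _ = _ := by
          rw [← Finset.sum_mul, ← Finset.sum_div, sum_cesaroWeight hα]
          ring
  · have := isFiniteMeasure_cdKernel (hμ (n - k)) k
    exact integrable_of_ae_abs_le ((withDensity_absolutelyContinuous _ _).ae_le (hR _))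
      (by fun_prop)

theorem TendstoWeakly.unique {ρ : ℕ → Measure ℝ} {ν ν' : Measure ℝ} (h : TendstoWeakly ρ ν)
    (h' : TendstoWeakly ρ ν') : ν = ν' := by
  have hfin : ∀ {κ : Measure ℝ}, TendstoWeakly ρ κ → IsFiniteMeasure κ := fun hκ =>
    ((integrable_const_iff_isFiniteMeasure one_ne_zero).1 (hκ (fun _ => (1 : ℝ)) continuous_const).1)
  have := hfin h
  have := hfin h'
  exact ext_of_forall_integral_eq_of_IsFiniteMeasure fun f =>
    tendsto_nhds_unique (h f f.continuous).2 (h' f f.continuous).2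

theorem integrable_indicator_Icc {ρ : Measure ℝ} [IsFiniteMeasure ρ] {f : ℝ → ℝ}
    (hf : ContinuousOn f (Set.Icc (-1) 1)) : Integrable ((Set.Icc (-1) 1).indicator f) ρ :=
  (integrable_indicator_iff measurableSet_Icc).2 (hf.integrableOn_compact isCompact_Icc)

theorem setIntegral_Icc_meanMeasure (hα : 0 < α) (hμ : ∀ k, IsOrthogonalityMeasure (μ k))
    {f : ℝ → ℝ} (hf : ContinuousOn f (Set.Icc (-1) 1)) (n : ℕ) :
    ∫ x in Set.Icc (-1) 1, f x ∂(meanMeasure (cesaroWeight α) μ n) =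
      ∑ k ∈ Finset.range (n + 1), gbinom ((n - k : ℕ) + α - 1) (n - k : ℕ) / gbinom (n + α) n *
        ∫ x in Set.Icc (-1) 1, f x * (orthoPoly (μ (n - k)) k).eval x ^ 2 ∂(μ (n - k)) := by
  rw [← integral_indicator measurableSet_Icc, integral_meanMeasure hα fun k => by
    have := isFiniteMeasure_orthoPoly_sq (hμ (n - k)) k
    exact integrable_indicator_Icc hf]
  refine Finset.sum_congr rfl fun k _ => ?_
  rw [← integral_indicator measurableSet_Icc]
  simp only [Set.indicator_mul_left]
  rw [cesaroWeight, cesaroTau, cesaroSeq, one_div_mul_eq_div]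

theorem cesaroWeight_div_cesaroNorm (hα : 0 < α) (n k : ℕ) :
    cesaroWeight α n k / cesaroNorm α n =
      gbinom ((n - k : ℕ) + α - 1) (n - k : ℕ) / gbinom (n + α + 1) n := by
  have h1 := (cesaroSeq_pos (by linarith : 0 < α + 1) n).ne'
  have e : gbinom (n + α + 1) n = cesaroSeq (α + 2) n := by
    rw [cesaroSeq]; congr 1; ring
  rw [e, cesaroWeight_eq, cesaroNorm_eq hα, div_div_div_cancel_right₀ h1]
  rfl

theorem setIntegral_Icc_cdMeanMeasure (hα : 0 < α) (hμ : ∀ k, IsOrthogonalityMeasure (μ k))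
    {f : ℝ → ℝ} (hf : ContinuousOn f (Set.Icc (-1) 1)) (n : ℕ) :
    ∫ x in Set.Icc (-1) 1, f x ∂(cdMeanMeasure (cesaroWeight α) (cesaroNorm α) μ n) =
      ∑ k ∈ Finset.range (n + 1),
        gbinom ((n - k : ℕ) + α - 1) (n - k : ℕ) / gbinom (n + α + 1) n *
        ∫ x in Set.Icc (-1) 1, f x * cdKernel (μ (n - k)) k x x ∂(μ (n - k)) := by
  rw [← integral_indicator measurableSet_Icc, integral_cdMeanMeasure hα fun k => by
    have := isFiniteMeasure_cdKernel (hμ (n - k)) k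
    exact integrable_indicator_Icc hf]
  refine Finset.sum_congr rfl fun k _ => ?_
  rw [← integral_indicator measurableSet_Icc]
  simp only [Set.indicator_mul_left, cesaroWeight_div_cesaroNorm hα]

theorem setIntegral_Icc_zeroMeanMeasure (hα : 0 < α) (f : ℝ → ℝ) (n : ℕ) :
    ∫ x in Set.Icc (-1) 1, f x ∂(zeroMeanMeasure (cesaroWeight α) (cesaroNorm α) μ n) =
      ∑ k ∈ Finset.range (n + 1),
        gbinom ((n - k : ℕ) + α - 1) (n - k : ℕ) / gbinom (n + α + 1) n *
        ∑ x ∈ zeros (μ (n - k)) (k + 1) with x ∈ Set.Icc (-1) 1, f x := by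
  classical
  rw [← integral_indicator measurableSet_Icc, integral_zeroMeanMeasure hα]
  refine Finset.sum_congr rfl fun k _ => ?_
  rw [cesaroWeight_div_cesaroNorm hα, Finset.sum_filter]
  simp only [Set.indicator_apply]

end means

end MeanNevai

end

theorem mainTheorem5 (α : ℝ) (hα : 0 < α) (μ : ℕ → MeasureTheory.Measure ℝ)
    (hμ : ∀ k, MeanNevai.IsOrthogonalityMeasure (μ k))
    (hclass : MeanNevai.InMeanNevaiClass (MeanNevai.cesaroWeight α) μ (fun la lb =>
      (if la = 0 then 1 else 0) * (2 : ℝ)⁻¹ ^ lb * (MeanNevai.gbinom ((α + lb) / 2) (α / 2))⁻¹)) :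
    -- the equilibrium measure exists, is unique, and is the Gegenbauer distribution
    (∀ ν : MeasureTheory.Measure ℝ,
      MeanNevai.IsEquilibriumMeasure (MeanNevai.cesaroWeight α) μ ν ↔
        ν = MeanNevai.gegenbauerMeasure α) ∧
    MeanNevai.gegenbauerMass α =
      Real.pi * (2 : ℝ) ^ (1 - α) * MeanNevai.gbinom (α - 1) (α / 2) ∧
    -- it is also the weak limit of the means of CD kernels and of the mean root distributions
    MeanNevai.TendstoWeakly
      (MeanNevai.cdMeanMeasure (MeanNevai.cesaroWeight α) (MeanNevai.cesaroNorm α) μ)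
      (MeanNevai.gegenbauerMeasure α) ∧
    MeanNevai.TendstoWeakly
      (MeanNevai.zeroMeanMeasure (MeanNevai.cesaroWeight α) (MeanNevai.cesaroNorm α) μ)
      (MeanNevai.gegenbauerMeasure α) ∧
    -- the three explicit limits for functions continuous on `[-1, 1]`
    ∀ f : ℝ → ℝ, ContinuousOn f (Set.Icc (-1) 1) →
      Tendsto (fun n : ℕ => ∑ k ∈ Finset.range (n + 1),
          MeanNevai.gbinom ((n - k : ℕ) + α - 1) (n - k : ℕ) / MeanNevai.gbinom (n + α) n *
            ∫ x in Set.Icc (-1) 1, f x * (MeanNevai.orthoPoly (μ (n - k)) k).eval x ^ 2 ∂(μ (n - k)))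
        atTop (𝓝 (1 / MeanNevai.gegenbauerMass α *
          ∫ x in (-1 : ℝ)..1, f x * (1 - x ^ 2) ^ ((α - 1) / 2))) ∧
      Tendsto (fun n : ℕ => ∑ k ∈ Finset.range (n + 1),
          MeanNevai.gbinom ((n - k : ℕ) + α - 1) (n - k : ℕ) / MeanNevai.gbinom (n + α + 1) n *
            ∫ x in Set.Icc (-1) 1, f x * MeanNevai.cdKernel (μ (n - k)) k x x ∂(μ (n - k)))
        atTop (𝓝 (1 / MeanNevai.gegenbauerMass α *
          ∫ x in (-1 : ℝ)..1, f x * (1 - x ^ 2) ^ ((α - 1) / 2))) ∧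
      Tendsto (fun n : ℕ => ∑ k ∈ Finset.range (n + 1),
          MeanNevai.gbinom ((n - k : ℕ) + α - 1) (n - k : ℕ) / MeanNevai.gbinom (n + α + 1) n *
            ∑ x ∈ MeanNevai.zeros (μ (n - k)) (k + 1) with x ∈ Set.Icc (-1) 1, f x)
        atTop (𝓝 (1 / MeanNevai.gegenbauerMass α *
          ∫ x in (-1 : ℝ)..1, f x * (1 - x ^ 2) ^ ((α - 1) / 2))) := by
  have hmean := MeanNevai.tendstoWeakly_meanMeasure hα hμ hclass
  obtain ⟨R, -, hR⟩ := MeanNevai.exists_ae_abs_le hμ hclass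
  have hcd := MeanNevai.tendstoWeakly_cdMeanMeasure hα hμ hR hmean
  have := MeanNevai.isFiniteMeasure_gegenbauerMeasure hα
  have hlt := MeanNevai.ae_abs_lt_one_gegenbauerMeasure α
  have hzero := MeanNevai.tendstoWeakly_zeroMeanMeasure hα hμ hclass
    (hlt.mono fun x hx => hx.le) hcd
  refine ⟨fun ν => ⟨fun h => h.unique hmean, fun h => h ▸ hmean⟩,
    MeanNevai.gegenbauerMass_eq_gbinom hα, hcd, hzero, fun f hf => ?_⟩
  have := MeanNevai.isFiniteMeasure_meanMeasure hμ (MeanNevai.cesaroWeight α)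
  have := MeanNevai.isFiniteMeasure_cdMeanMeasure hμ (MeanNevai.cesaroWeight α)
    (MeanNevai.cesaroNorm α)
  have := fun n => MeanNevai.isFiniteMeasure_zeroMeanMeasure (μ := μ) (MeanNevai.cesaroWeight α)
    (MeanNevai.cesaroNorm α) n
  rw [← MeanNevai.setIntegral_Icc_gegenbauerMeasure hα]
  exact ⟨(hmean.tendsto_setIntegral_Icc hlt hf).congr
      (MeanNevai.setIntegral_Icc_meanMeasure hα hμ hf),
    (hcd.tendsto_setIntegral_Icc hlt hf).congr
      (MeanNevai.setIntegral_Icc_cdMeanMeasure hα hμ hf),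
    (hzero.tendsto_setIntegral_Icc hlt hf).congr
      (MeanNevai.setIntegral_Icc_zeroMeanMeasure hα f)⟩
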